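/- All graphs are finite, simple and undirected. A *2-edge-coloured graph* $(G,C)$ is a graph $G$ with a set $C\subseteq E(G)$ of negative edges (its *signature*). *Re-signing* at a vertex $v$ inverts the sign of every edge incident with $v$; two 2-edge-coloured graphs are equivalent if one is obtained from the other by a series of re-signings, and a *signed graph* $[G,\Sigma]$ is the equivalence class of $(G,\Sigma)$, whose members are called its representatives. A homomorphism of $(G,C)$ to $(H,D)$ is a map $V(G)\to V(H)$ that sends every edge to an edge of the same sign; a homomorphism of $[G,\Sigma]$ to $[H,\Pi]$ is a homomorphism of some representative of $[G,\Sigma]$ to some representative of $[H,\Pi]$. It is surjective if every vertex and every edge of $H$ is the image of a vertex, respectively an edge, of $G$; the target is then a homomorphic image of the source. A 2-edge-coloured (respectively signed) *clique* is a 2-edge-coloured (respectively signed) graph that is its unique homomorphic image up to isomorphism. Let $\psi_2(G,C)$ be the largest order of a 2-edge-coloured clique that is a homomorphic image of $(G,C)$, and $\psi_s[G,\Sigma]$ the largest order of a signed clique that is a homomorphic image of $[G,\Sigma]$. Put $$\psi_{\min}[G,\Sigma]=\min\{\psi_2(G,C) : (G,C)\in[G,\Sigma]\},$$ $$\psi_{\min}(G)=\min\{\psi_2(G,C)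 : C\subseteq E(G)\},\qquad \psi_{\min}^{signed}(G)=\min\{\psi_s[G,\Sigma] : \Sigma\subseteq E(G)\}.$$ Consider the following decision problems, with graphs encoded over $\{0,1\}$ by their order in unary and their adjacency matrix, a signed graph by any of its representatives (adjacency matrix and matrix of negative edges), and integers by a sign bit and their binary digits: - **Signed-min-an**: given a signed graph $[G,\Sigma]$ and an integer $k$, is $\psi_{\min}[G,\Sigma]\ge k$? - **Min-2ec-an**: given a graph $G$ and an integer $k$, is $\psi_{\min}(G)\ge k$? - **Min-signed-an**: given a graph $G$ and an integer $k$, is $\psi_{\min}^{signed}(G)\ge k$? **Theorem.** All three problems belong to the class $\Pi_2$ of the polynomial hierarchy, that is, the class of the languages $L\subseteq\{0,1\}^*$ for which there are a polynomial $p$ and a ternary relation $R$ on $\{0,1\}^*$, decidable in polynomial time by a Turing machine, such that for every $x$: $x\in L$ if and only if for every $u$ with $|u|\le p(|x|)$ there is $v$ with $|v|\le p(|x|)$ and $R(x,u,v)$. -/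

import Mathlib

/-! ## 2-edge-coloured graphs -/

/-- A 2-edge-coloured graph `(G, C)` on the vertex set `V`: a simple graph `G` together with
its signature `C ⊆ E(G)`, the set of negative edges. -/
@[ext]
structure TwoEdgeColoredGraph (V : Type) where
  /-- the underlying graph -/
  graph : SimpleGraph V
  /-- the set of negative edges -/
  neg : Set (Sym2 V)
  neg_subset : neg ⊆ graph.edgeSet

namespace TwoEdgeColoredGraph

variable {V W : Type}

/-- A homomorphism of 2-edge-coloured graphs: edges are mapped to edges of the same sign. -/
def IsHom (φ : V → W) (G : TwoEdgeColoredGraph V) (H : TwoEdgeColoredGraph W) : Prop :=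
  ∀ u v, G.graph.Adj u v →
    H.graph.Adj (φ u) (φ v) ∧ (s(u, v) ∈ G.neg ↔ s(φ u, φ v) ∈ H.neg)

/-- A surjective homomorphism: the codomain is the homomorphic image, that is, every vertex
and every edge of `H` is the image of a vertex, respectively of an edge, of `G`. -/
def IsSurjHom (φ : V → W) (G : TwoEdgeColoredGraph V) (H : TwoEdgeColoredGraph W) : Prop :=
  IsHom φ G H ∧ Function.Surjective φ ∧
    ∀ x y, H.graph.Adj x y → ∃ u v, G.graph.Adj u v ∧ φ u = x ∧ φ v = y

/-- `(G, C) →₂ (H, D)`: there is a surjective homomorphism of `(G, C)` to `(H, D)`. -/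
def MapsOnto (G : TwoEdgeColoredGraph V) (H : TwoEdgeColoredGraph W) : Prop :=
  ∃ φ : V → W, IsSurjHom φ G H

/-- Isomorphism of 2-edge-coloured graphs. -/
def Isomorphic (G : TwoEdgeColoredGraph V) (H : TwoEdgeColoredGraph W) : Prop :=
  ∃ e : V ≃ W, IsHom e G H ∧ IsHom e.symm H G

/-- A 2-edge-coloured clique: a 2-edge-coloured graph that is its unique homomorphic image,
up to isomorphism. -/
def IsClique (G : TwoEdgeColoredGraph V) : Prop :=
  ∀ (W : Type) (H : TwoEdgeColoredGraph W), G.MapsOnto H → G.Isomorphic H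

/-- The achromatic number `ψ₂(G, C)`: the largest order of a 2-edge-coloured clique onto which
`(G, C)` maps by a surjective homomorphism. -/
noncomputable def achromaticNumber (G : TwoEdgeColoredGraph V) : ℕ :=
  sSup {m : ℕ | ∃ K : TwoEdgeColoredGraph (Fin m), K.IsClique ∧ G.MapsOnto K}

/-- Re-signing at the vertex `v`: the sign of every edge incident with `v` is inverted. -/
def resign (G : TwoEdgeColoredGraph V) (v : V) : TwoEdgeColoredGraph V where
  graph := G.graph
  neg := {e | e ∈ G.graph.edgeSet ∧ ((e ∈ G.neg ∧ v ∉ e) ∨ (e ∉ G.neg ∧ v ∈ e))}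
  neg_subset := fun _ he => he.1

theorem resign_resign (G : TwoEdgeColoredGraph V) (v : V) : (G.resign v).resign v = G := by
  ext e
  · rfl
  · have h := @G.neg_subset e
    simp only [resign, Set.mem_ofPred_eq]
    tauto

/-- Two 2-edge-coloured graphs are equivalent if one can go from one to the other by a series
of re-signings. -/
def Equivalent (G H : TwoEdgeColoredGraph V) : Prop :=
  Relation.ReflTransGen (fun A B => ∃ v, B = A.resign v) G H

theorem equivalent_equivalence : Equivalence (Equivalent (V := V)) where
  refl _ := Relation.ReflTransGen.refl
  symm h := by
    induction h with
    | refl => exact Relation.ReflTransGen.refl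
    | tail _ hs ih =>
      obtain ⟨v, rfl⟩ := hs
      exact Relation.ReflTransGen.head ⟨v, (resign_resign _ v).symm⟩ ih
  trans h₁ h₂ := Relation.ReflTransGen.trans h₁ h₂

/-- The equivalence relation generated by re-signing. -/
def resignSetoid (V : Type) : Setoid (TwoEdgeColoredGraph V) where
  r := Equivalent
  iseqv := equivalent_equivalence

end TwoEdgeColoredGraph

/-! ## Signed graphs -/

/-- A signed graph: a class of 2-edge-coloured graphs up to re-signing. -/
def SignedGraph (V : Type) : Type :=
  Quotient (TwoEdgeColoredGraph.resignSetoid V)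

/-- The signed graph `[G, Σ]` of which the 2-edge-coloured graph `(G, Σ)` is a representative. -/
def TwoEdgeColoredGraph.toSigned {V : Type} (G : TwoEdgeColoredGraph V) : SignedGraph V :=
  Quotient.mk (TwoEdgeColoredGraph.resignSetoid V) G

namespace SignedGraph

variable {V W : Type}

/-- A homomorphism of signed graphs: a homomorphism between some representatives. -/
def IsHom (φ : V → W) (S : SignedGraph V) (T : SignedGraph W) : Prop :=
  ∃ (G : TwoEdgeColoredGraph V) (H : TwoEdgeColoredGraph W),
    G.toSigned = S ∧ H.toSigned = T ∧ TwoEdgeColoredGraph.IsHom φ G H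

/-- `[G, Σ] →ₛ [H, Π]`: there is a surjective homomorphism of `[G, Σ]` to `[H, Π]`. -/
def MapsOnto (S : SignedGraph V) (T : SignedGraph W) : Prop :=
  ∃ (G : TwoEdgeColoredGraph V) (H : TwoEdgeColoredGraph W),
    G.toSigned = S ∧ H.toSigned = T ∧ G.MapsOnto H

/-- Isomorphism of signed graphs. -/
def Isomorphic (S : SignedGraph V) (T : SignedGraph W) : Prop :=
  ∃ e : V ≃ W, IsHom e S T ∧ IsHom e.symm T S

/-- A signed clique: a signed graph that is its unique homomorphic image, up to isomorphism. -/
def IsClique (S : SignedGraph V) : Prop :=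
  ∀ (W : Type) (T : SignedGraph W), S.MapsOnto T → S.Isomorphic T

/-- The achromatic number `ψₛ[G, Σ]`: the largest order of a signed clique onto which
`[G, Σ]` maps by a surjective homomorphism. -/
noncomputable def achromaticNumber (S : SignedGraph V) : ℕ :=
  sSup {m : ℕ | ∃ K : SignedGraph (Fin m), K.IsClique ∧ S.MapsOnto K}

/-- `ψ_min[G, Σ]`, the minimum of `ψ₂(G, C)` over the representatives `(G, C)` of `[G, Σ]`. -/
noncomputable def minAchromaticNumber (S : SignedGraph V) : ℕ :=
  sInf {m : ℕ | ∃ G : TwoEdgeColoredGraph V, G.toSigned = S ∧ G.achromaticNumber = m}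

end SignedGraph

/-! ## Min-achromatic numbers of graphs -/

/-- `ψ_min(G)`, the minimum of `ψ₂(G, C)` over all signatures `C ⊆ E(G)`. -/
noncomputable def min2ecAchromaticNumber {V : Type} (G : SimpleGraph V) : ℕ :=
  sInf {m : ℕ | ∃ C : TwoEdgeColoredGraph V, C.graph = G ∧ C.achromaticNumber = m}

/-- `ψ_min^signed(G)`, the minimum of `ψₛ[G, Σ]` over all signatures `Σ ⊆ E(G)`. -/
noncomputable def minSignedAchromaticNumber {V : Type} (G : SimpleGraph V) : ℕ :=
  sInf {m : ℕ | ∃ C : TwoEdgeColoredGraph V, C.graph = G ∧ C.toSigned.achromaticNumber = m}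

/-! ## The class `Π₂` of the polynomial hierarchy -/

/-- Three bit strings on one input tape, written `x#u#v`; the separator `#` is `none`. -/
def encodeTriple (t : List Bool × List Bool × List Bool) : List (Option Bool) :=
  t.1.map some ++ none :: (t.2.1.map some ++ none :: t.2.2.map some)

/-- The ternary relation `R` on bit strings is decided by a Turing machine in polynomial time. -/
def PolyTimeDecidable₃ (R : List Bool → List Bool → List Bool → Prop) : Prop :=
  ∃ f : List Bool × List Bool × List Bool → Bool,
    (∀ x u v, f (x, u, v) = true ↔ R x u v) ∧
      Nonempty (Turing.TM2ComputableInPolyTime encodeTriple Computability.encodeBool f)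

/-- The class `Π₂` of the polynomial hierarchy: the languages `L ⊆ {0,1}*` such that, for some
polynomial `p` and some polynomial-time decidable relation `R`, a word `x` is in `L` if and only if
for every `u` with `|u| ≤ p(|x|)` there is `v` with `|v| ≤ p(|x|)` and `R(x, u, v)`. -/
def PiTwoP : Set (Language Bool) :=
  {L | ∃ (p : Polynomial ℕ) (R : List Bool → List Bool → List Bool → Prop),
    PolyTimeDecidable₃ R ∧
      ∀ x : List Bool, x ∈ L ↔
        ∀ u : List Bool, u.length ≤ p.eval x.length →
          ∃ v : List Bool, v.length ≤ p.eval x.length ∧ R x u v}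

/-! ## Encoding of instances -/

open Classical in
/-- The `n × n` matrix of a binary relation on `{0, …, n - 1}`, row by row. -/
noncomputable def encodeMatrix {n : ℕ} (r : Fin n → Fin n → Prop) : List Bool :=
  (List.finRange n).flatMap fun i => (List.finRange n).map fun j => decide (r i j)

/-- A graph on `{0, …, n - 1}`: the word `1ⁿ0`, then the adjacency matrix. -/
noncomputable def encodeGraph {n : ℕ} (G : SimpleGraph (Fin n)) : List Bool :=
  List.replicate n true ++ false :: encodeMatrix G.Adj

/-- A 2-edge-coloured graph on `{0, …, n - 1}`: its underlying graph, then the matrix of the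
negative edges. -/
noncomputable def encodeTwoEdgeColoredGraph {n : ℕ} (G : TwoEdgeColoredGraph (Fin n)) :
    List Bool :=
  encodeGraph G.graph ++ encodeMatrix fun i j => s(i, j) ∈ G.neg

/-- An integer: a sign bit, then the binary digits of the absolute value. -/
def encodeInteger (k : ℤ) : List Bool :=
  decide (k < 0) :: Computability.encodeNat k.natAbs

/-! ## The three decision problems -/

/-- Given a signed graph `[G, Σ]` (by a representative) and an integer `k`,
is `ψ_min[G, Σ] ≥ k`? -/
def SignedMinAn : Language Bool :=
  {w | ∃ (n : ℕ) (G : TwoEdgeColoredGraph (Fin n)) (k : ℤ),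
    w = encodeTwoEdgeColoredGraph G ++ encodeInteger k ∧ k ≤ G.toSigned.minAchromaticNumber}

/-- Given a graph `G` and an integer `k`, is `ψ_min(G) ≥ k`? -/
def MinTwoEcAn : Language Bool :=
  {w | ∃ (n : ℕ) (G : SimpleGraph (Fin n)) (k : ℤ),
    w = encodeGraph G ++ encodeInteger k ∧ k ≤ min2ecAchromaticNumber G}

/-- Given a graph `G` and an integer `k`, is `ψ_min^signed(G) ≥ k`? -/
def MinSignedAn : Language Bool :=
  {w | ∃ (n : ℕ) (G : SimpleGraph (Fin n)) (k : ℤ),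
    w = encodeGraph G ++ encodeInteger k ∧ k ≤ minSignedAchromaticNumber G}

/-! A minimum of achromatic numbers is at least `k` exactly if every signature (or every
representative) admits a clique of order at least `k` as a homomorphic image, apart from the trivial
case `k ≤ 0`. This has the shape ∀∃, so what is needed is that the inner condition has short
certificates that can be checked in polynomial time.

Being a clique quantifies over all homomorphic images, but it amounts to a condition on pairs of
vertices. Two vertices can be identified unless they are adjacent or joined by a path of length two
with edges of different signs (`isClique_iff`). Up to re-signing, the obstruction is adjacency or a
4-cycle with an odd number of negative edges in which the two vertices are opposite
(`toSigned_isClique_iff`). Representatives of a signed graph are its switchings at vertex sets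
(`equivalent_iff`), so they too have short codes.

The universal word `u` therefore codes a signature or a switching set. The existential word `v`
codes a map, the adjacency and the signs of its image and, for `ψₛ`, a switching set. The number `k`
is given in binary, so `v` also lists the values of the final segments of its digits; they stay
below `|x|` when `k` is at most the order of an image (`exists_certifies_iff`).

Polynomial time is settled once for all three problems. A first-order sentence about the word
`x#u#v`, with quantifiers over numbers below its length and with sums and products in its indices,
is evaluated by nested loops over unary counters (`WordFormula.does_prog`). The loops are written in
a small stack language that compiles to multi-stack Turing machines (`StackProg.Runs.iterate_step`).
It remains to write the validity of instance and certificate as such a sentence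
(`holds_instanceFormula`, `mem_PiTwoP_of_certifies`). -/

/-! ## Structured programs over stacks -/

/-- A tape symbol: a bit, or the separator `none`. -/
abbrev TapeSym := Option Bool

/-- A state of a stack program: the symbol read last, a flag, and the stacks. -/
@[ext]
structure StackState (K : Type) where
  cur : Option TapeSym
  flag : Bool
  stk : K → List TapeSym

/-- The elementary instructions of stack programs. -/
inductive StackOp (K : Type)
  /-- push a fixed symbol -/
  | push (k : K) (a : TapeSym)
  /-- push the symbol read last, if there is one -/
  | pushCur (k : K)
  /-- pop a symbol -/
  | pop (k : K)
  /-- read the top symbol -/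
  | peek (k : K)
  /-- move the top symbol of a stack, if there is one, to another stack -/
  | move (k k' : K)
  /-- update the flag -/
  | test (f : Option TapeSym → Bool → Bool)

/-- Stack programs; `drain k p` pops symbols from the stack `k` and runs `p` after each of
them, until the stack is empty. -/
inductive StackProg (K : Type)
  | op (o : StackOp K)
  | seq (p q : StackProg K)
  | ite (c : Option TapeSym → Bool → Bool) (p q : StackProg K)
  | drain (k : K) (p : StackProg K)

section Semantics

variable {K : Type} [DecidableEq K]

open Function Turing

/-- The effect of an instruction. -/
def StackOp.run : StackOp K → StackState K → StackState K
  | push k a, s => { s with stk := update s.stk k (a :: s.stk k) }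
  | pushCur k, s => { s with stk := update s.stk k (s.cur.toList ++ s.stk k) }
  | pop k, s => { s with cur := (s.stk k).head?, stk := update s.stk k (s.stk k).tail }
  | peek k, s => { s with cur := (s.stk k).head? }
  | move k k', s =>
    let S := update s.stk k (s.stk k).tail
    { s with cur := (s.stk k).head?, stk := update S k' ((s.stk k).head?.toList ++ S k') }
  | test f, s => { s with flag := f s.cur s.flag }

/-- `p.Runs s t s'`: the program `p`, started in `s`, ends in `s'` after `t` steps. -/
inductive StackProg.Runs : StackProg K → StackState K → ℕ → StackState K → Prop
  | op (o : StackOp K) (s : StackState K) : Runs (op o) s 1 (o.run s)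
  | seq {p q : StackProg K} {s s' s'' : StackState K} {t t' : ℕ} :
      Runs p s t s' → Runs q s' t' s'' → Runs (seq p q) s (t + t') s''
  | ite_pos {c : Option TapeSym → Bool → Bool} {p q : StackProg K} {s s' : StackState K} {t : ℕ} :
      c s.cur s.flag = true → Runs p s t s' → Runs (ite c p q) s (1 + t) s'
  | ite_neg {c : Option TapeSym → Bool → Bool} {p q : StackProg K} {s s' : StackState K} {t : ℕ} :
      c s.cur s.flag = false → Runs q s t s' → Runs (ite c p q) s (1 + t) s'
  | drain_nil {k : K} {p : StackProg K} {s : StackState K} :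
      s.stk k = [] → Runs (drain k p) s 1 { s with cur := none }
  | drain_cons {k : K} {p : StackProg K} {s s' s'' : StackState K} {a : TapeSym} {l : List TapeSym}
      {t t' : ℕ} :
      s.stk k = a :: l → Runs p { s with cur := some a, stk := update s.stk k l } t s' →
      Runs (drain k p) s' t' s'' → Runs (drain k p) s (1 + (t + t')) s''

/-! ### Compilation to multi-stack Turing machines -/

/-- The stack alphabets of the compiled machine: the output stack `none` holds bits. -/
def StackAlphabet (K : Type) : Option K → Type
  | none => Bool
  | some _ => TapeSym

/-- The labels of the machine code of a program. -/
def StackProg.Label : StackProg K → Type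
  | op _ => Unit
  | seq p q => p.Label ⊕ q.Label
  | ite _ p q => Option (p.Label ⊕ q.Label)
  | drain _ p => Option p.Label

instance StackProg.fintypeLabel : (p : StackProg K) → Fintype p.Label
  | op _ => inferInstanceAs (Fintype Unit)
  | seq p q =>
    let _ := p.fintypeLabel
    let _ := q.fintypeLabel
    inferInstanceAs (Fintype (p.Label ⊕ q.Label))
  | ite _ p q =>
    let _ := p.fintypeLabel
    let _ := q.fintypeLabel
    inferInstanceAs (Fintype (Option (p.Label ⊕ q.Label)))
  | drain _ p =>
    let _ := p.fintypeLabel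
    inferInstanceAs (Fintype (Option p.Label))

/-- The label at which the machine code of a program starts. -/
def StackProg.entry : (p : StackProg K) → p.Label
  | op _ => ()
  | seq p _ => Sum.inl p.entry
  | ite _ _ _ => none
  | drain _ _ => none

/-- Machine statements over the stacks `Option K`, with a symbol and a flag as memory. -/
abbrev StackStmt (K Λ : Type) := TM2.Stmt (StackAlphabet K) Λ (Option TapeSym × Bool)

/-- The machine code of an instruction, followed by a jump to `exit`. -/
def StackOp.code {Λ : Type} (exit : Λ) : StackOp K → StackStmt K Λ
  | push k a => .push (some k) (fun _ => a) (.goto fun _ => exit)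
  | pushCur k =>
    .branch (fun v => v.1.isSome)
      (.push (some k) (fun v => v.1.getD none) (.goto fun _ => exit)) (.goto fun _ => exit)
  | pop k => .pop (some k) (fun v a => (a, v.2)) (.goto fun _ => exit)
  | peek k => .peek (some k) (fun v a => (a, v.2)) (.goto fun _ => exit)
  | move k k' =>
    .pop (some k) (fun v a => (a, v.2)) (.branch (fun v => v.1.isSome)
      (.push (some k') (fun v => v.1.getD none) (.goto fun _ => exit)) (.goto fun _ => exit))
  | test f => .load (fun v => (v.1, f v.1 v.2)) (.goto fun _ => exit)

/-- The machine code of a program, its labels being renamed by `e`, followed by a jump to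
`exit`. -/
def StackProg.code {Λ : Type} : (p : StackProg K) → (p.Label → Λ) → Λ → p.Label → StackStmt K Λ
  | op o, _, exit, _ => o.code exit
  | seq p q, e, exit, l =>
    match l with
    | Sum.inl l => p.code (fun l => e (Sum.inl l)) (e (Sum.inr q.entry)) l
    | Sum.inr l => q.code (fun l => e (Sum.inr l)) exit l
  | ite c p q, e, exit, l =>
    match l with
    | none => .branch (fun v => c v.1 v.2) (.goto fun _ => e (some (Sum.inl p.entry)))
        (.goto fun _ => e (some (Sum.inr q.entry)))
    | some (Sum.inl l) => p.code (fun l => e (some (Sum.inl l))) exit l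
    | some (Sum.inr l) => q.code (fun l => e (some (Sum.inr l))) exit l
  | drain k p, e, exit, l =>
    match l with
    | none => .pop (some k) (fun v a => (a, v.2)) (.branch (fun v => v.1.isSome)
        (.goto fun _ => e (some p.entry)) (.goto fun _ => exit))
    | some l => p.code (fun l => e (some l)) (e none) l

/-- The stacks of the compiled machine in a given state; the output stack is empty. -/
def StackState.stacks (s : StackState K) : (k : Option K) → List (StackAlphabet K k)
  | none => []
  | some k => s.stk k

/-- The configuration of the compiled machine at the label `l` in a given state. -/
def StackState.cfg {Λ : Type} (s : StackState K) (l : Λ) :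
    TM2.Cfg (StackAlphabet K) Λ (Option TapeSym × Bool) :=
  ⟨some l, (s.cur, s.flag), s.stacks⟩

theorem StackState.update_stacks (s : StackState K) (k : K) (x : List TapeSym) :
    update s.stacks (some k) x = StackState.stacks { s with stk := update s.stk k x } := by
  funext k'
  rcases k' with _ | k'
  · rfl
  · by_cases h : k' = k
    · subst h
      exact (update_self (some k') x s.stacks).trans (update_self k' x s.stk).symm
    · have h' : some k' ≠ some k := by simpa using h
      exact (update_of_ne h' x s.stacks).trans (update_of_ne h x s.stk).symm

/-- `TM2.step` executes a whole statement up to its `goto`, so even `move`, a pop followed by a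
conditional push, is one machine step. -/
theorem StackOp.step_code {Λ : Type} (M : Λ → StackStmt K Λ) (o : StackOp K) (l exit : Λ)
    (h : M l = o.code exit) (s : StackState K) :
    TM2.step M (s.cfg l) = some ((o.run s).cfg exit) := by
  rcases s with ⟨c, b, S⟩
  rw [StackState.cfg, TM2.step, h]
  cases o with
  | push k a => 
    simp only [StackOp.code, TM2.stepAux, StackState.cfg]
    erw [StackState.update_stacks]
    rfl
  | pushCur k =>
    cases c with
    | none => simp [StackOp.code, TM2.stepAux, StackState.cfg, StackOp.run]
    | some a =>
      simp only [StackOp.code, TM2.stepAux, StackState.cfg, Option.isSome_some, cond_true]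
      erw [StackState.update_stacks]
      rfl
  | pop k =>
    simp only [StackOp.code, TM2.stepAux, StackState.cfg]
    erw [StackState.update_stacks]
    rfl
  | peek k => rfl
  | test f => rfl
  | move k k' =>
    simp only [StackOp.code, TM2.stepAux, StackState.cfg]
    erw [StackState.update_stacks]
    simp only [StackState.stacks, StackOp.run]
    cases hS : S k with
    | nil =>
      rw [List.head?_nil, Option.toList_none, List.nil_append, update_eq_self]
      rfl
    | cons a t =>
      erw [StackState.update_stacks]
      rfl

theorem iterate_bind_trans {α : Type} {f : α → Option α} {a b c : α} {t t' : ℕ}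
    (h : (flip bind f)^[t] (some a) = some b) (h' : (flip bind f)^[t'] (some b) = some c) :
    (flip bind f)^[t + t'] (some a) = some c := by
  rw [Nat.add_comm, iterate_add_apply, h, h']

theorem iterate_bind_one {α : Type} {f : α → Option α} {a b : α} (h : f a = some b) :
    (flip bind f)^[1] (some a) = some b := h

/-- The time in `Runs` is the exact number of machine steps. The renaming `e` and the label `exit`
are arbitrary because a subprogram sits inside a larger machine; the body of a `drain`, for
instance, exits to the head of its loop. -/
theorem StackProg.Runs.iterate_step {Λ : Type} (M : Λ → StackStmt K Λ) {p : StackProg K}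
    {s s' : StackState K} {t : ℕ} (h : p.Runs s t s') :
    ∀ (e : p.Label → Λ) (exit : Λ), (∀ l, M (e l) = p.code e exit l) →
      (flip bind (TM2.step M))^[t] (some (s.cfg (e p.entry))) = some (s'.cfg exit) := by
  induction h with
  | op o s => exact fun e exit he => iterate_bind_one (o.step_code M _ _ (he _) s)
  | @seq p q s s' s'' t t' _ _ ih₁ ih₂ =>
    intro e exit he
    exact iterate_bind_trans
      (ih₁ (fun l => e (Sum.inl l)) (e (Sum.inr q.entry)) fun l => he (Sum.inl l))
      (ih₂ (fun l => e (Sum.inr l)) exit fun l => he (Sum.inr l))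
  | @ite_pos c p q s s' t hc _ ih =>
    intro e exit he
    refine iterate_bind_trans (iterate_bind_one ?_)
      (ih (fun l => e (some (Sum.inl l))) exit fun l => he (some (Sum.inl l)))
    have := he none
    simp only [StackProg.entry, StackState.cfg, TM2.step, this, StackProg.code, TM2.stepAux, hc,
      cond_true]
  | @ite_neg c p q s s' t hc _ ih =>
    intro e exit he
    refine iterate_bind_trans (iterate_bind_one ?_)
      (ih (fun l => e (some (Sum.inr l))) exit fun l => he (some (Sum.inr l)))
    have := he none
    simp only [StackProg.entry, StackState.cfg, TM2.step, this, StackProg.code, TM2.stepAux, hc,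
      cond_false]
  | @drain_nil k p s hk =>
    intro e exit he
    refine iterate_bind_one ?_
    have := he none
    simp only [StackProg.entry, StackState.cfg, TM2.step, this, StackProg.code, TM2.stepAux]
    erw [StackState.update_stacks]
    simp only [StackState.stacks, hk]
    have hs : update s.stk k [] = s.stk := by rw [← hk, update_eq_self]
    change some (StackState.cfg ⟨none, s.flag, update s.stk k []⟩ exit) = _
    rw [hs]
    rfl
  | @drain_cons k p s s' s'' a l t t' hk _ _ ih₁ ih₂ =>
    intro e exit he
    refine iterate_bind_trans (iterate_bind_one ?_) (iterate_bind_trans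
      (ih₁ (fun l => e (some l)) (e none) fun l => he (some l)) (ih₂ e exit he))
    have := he none
    simp only [StackProg.entry, StackState.cfg, TM2.step, this, StackProg.code, TM2.stepAux]
    erw [StackState.update_stacks]
    simp only [StackState.stacks, hk]
    rfl

/-- The Turing machine of a program with the input stack `k₀`; at the end it pushes the flag on
the output stack. -/
def StackProg.machine [Fintype K] (p : StackProg K) (k₀ : K) : FinTM2 where
  K := Option K
  k₀ := some k₀
  k₁ := none
  Γ := StackAlphabet K
  Λ := Option p.Label
  main := some p.entry
  σ := Option TapeSym × Bool
  initialState := (none, false)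
  Γk₀Fin := inferInstanceAs (Fintype TapeSym)
  m
    | none => .push none (fun v => v.2) (.load (fun _ => (none, false)) .halt)
    | some l => p.code some none l

/-- The initial state of a program: the input is on the stack `k₀`, the other stacks are empty. -/
def StackState.init (k₀ : K) (w : List TapeSym) : StackState K :=
  ⟨none, false, update (fun _ => []) k₀ w⟩

/-- The summand `1` in `T + 1` is the final step at the label `none`, which outputs the flag and
halts. The program must leave its stacks empty, since a halting configuration may hold nothing but
the output. -/
theorem StackProg.polyTime [Fintype K] (p : StackProg K) (k₀ : K)
    (f : List Bool × List Bool × List Bool → Bool) (T : Polynomial ℕ)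
    (h : ∀ a, ∃ t ≤ T.eval (encodeTriple a).length, ∃ c,
      p.Runs (StackState.init k₀ (encodeTriple a)) t ⟨c, f a, fun _ => []⟩) :
    Nonempty (TM2ComputableInPolyTime encodeTriple Computability.encodeBool f) := by
  refine ⟨⟨⟨p.machine k₀, Equiv.refl TapeSym, Equiv.refl Bool⟩, T + 1, fun a => ?_⟩⟩
  have ht := (h a).choose_spec.1
  have hr := (h a).choose_spec.2
  refine ⟨⟨(h a).choose + 1, ?_⟩, by simpa using ht⟩
  obtain ⟨c, hr⟩ := hr
  refine iterate_bind_trans (b := StackState.cfg ⟨c, f a, fun _ => []⟩ none) ?_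
    (iterate_bind_one ?_)
  · have := hr.iterate_step (p.machine k₀).m some none fun _ => rfl
    refine Eq.trans ?_ this
    congr 2
    simp only [initList, StackState.cfg]
    congr 1
    funext k
    rcases k with _ | k
    · rfl
    · by_cases hk : k = k₀
      · subst hk
        refine (dif_pos rfl).trans ?_
        exact (List.map_id _).trans (update_self k (encodeTriple a) fun _ => []).symm
      · have : some k ≠ some k₀ := by simpa using hk
        exact (dif_neg this).trans (update_of_ne hk (encodeTriple a) fun _ => []).symm
  · simp only [FinTM2.step, StackState.cfg, TM2.step, StackProg.machine, TM2.stepAux]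
    refine congrArg some ?_
    refine congrArg (TM2.Cfg.mk none (none, false)) (funext fun k => ?_)
    rcases k with _ | k
    · rfl
    · rfl

end Semantics

section

/-! ### Running times of structured programs -/

open Function

namespace StackProg

variable {K : Type} [DecidableEq K]

/-- The program `p`, started in `s`, ends within `T` steps with the flag `f` and the
stacks `S`. -/
def Does (p : StackProg K) (T : ℕ) (s : StackState K) (f : Bool) (S : K → List TapeSym) : Prop :=
  ∃ t ≤ T, ∃ c, p.Runs s t ⟨c, f, S⟩

theorem Does.mono {p : StackProg K} {T T' : ℕ} {s : StackState K} {f : Bool}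
    {S : K → List TapeSym} (h : p.Does T s f S) (hT : T ≤ T') : p.Does T' s f S := by
  obtain ⟨t, ht, h⟩ := h
  exact ⟨t, ht.trans hT, h⟩

theorem does_op (o : StackOp K) (s : StackState K) :
    (op o).Does 1 s (o.run s).flag (o.run s).stk :=
  ⟨1, le_rfl, _, Runs.op o s⟩

theorem Does.congr {p : StackProg K} {T : ℕ} {s s' : StackState K} {f f' : Bool}
    {S S' : K → List TapeSym} (h : p.Does T s f S) (hf : s.flag = s'.flag := by rfl)
    (hc : s.cur = s'.cur := by rfl) (hs : ∀ x, s.stk x = s'.stk x := by intro x; rfl)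
    (hf' : f = f' := by rfl) (hS : ∀ x, S x = S' x := by intro x; rfl) : p.Does T s' f' S' := by
  obtain rfl : S = S' := funext hS
  obtain rfl : s = s' := StackState.ext hc hf (funext hs)
  exact hf' ▸ h

/-- `Does` forgets the symbol read last, so the second program has to work for every value of it. -/
theorem Does.seq {p q : StackProg K} {T T' : ℕ} {s : StackState K} {f f' : Bool}
    {S S' : K → List TapeSym} (hp : p.Does T s f S) (hq : ∀ c, q.Does T' ⟨c, f, S⟩ f' S') :
    (seq p q).Does (T + T') s f' S' := by
  obtain ⟨t, ht, c, hp⟩ := hp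
  obtain ⟨t', ht', c', hq⟩ := hq c
  exact ⟨t + t', add_le_add ht ht', c', hp.seq hq⟩

/-- In contrast to `Does.seq`, the symbol read by the first instruction remains known, as a
subsequent `test` or `pushCur` requires. -/
theorem does_op_seq {o : StackOp K} {q : StackProg K} {T : ℕ} {s : StackState K} {f : Bool}
    {S : K → List TapeSym} (hq : q.Does T (o.run s) f S) : (seq (op o) q).Does (1 + T) s f S := by
  obtain ⟨t, ht, c, hq⟩ := hq
  exact ⟨1 + t, add_le_add le_rfl ht, c, (Runs.op o s).seq hq⟩

/-- The program that does nothing. -/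
def skip : StackProg K :=
  op (.test fun _ f => f)

theorem does_skip (s : StackState K) : (skip : StackProg K).Does 1 s s.flag s.stk :=
  does_op _ s

theorem does_ite {c : Option TapeSym → Bool → Bool} {p q : StackProg K} {T : ℕ}
    {s : StackState K} {f : Bool} {S : K → List TapeSym}
    (hp : c s.cur s.flag = true → p.Does T s f S) (hq : c s.cur s.flag = false → q.Does T s f S) :
    (ite c p q).Does (1 + T) s f S := by
  cases hc : c s.cur s.flag with
  | true =>
    obtain ⟨t, ht, c, h⟩ := hp hc
    exact ⟨1 + t, add_le_add le_rfl ht, c, Runs.ite_pos hc h⟩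
  | false =>
    obtain ⟨t, ht, c, h⟩ := hq hc
    exact ⟨1 + t, add_le_add le_rfl ht, c, Runs.ite_neg hc h⟩

/-- Loop rule: `F i` and `I i` are the flag and the stacks after `i` rounds. Each round costs one
step for the pop besides the body, and the last `1` is the pop that finds the stack empty. -/
theorem does_drain {k : K} {p : StackProg K} {l : List TapeSym} (F : ℕ → Bool)
    (I : ℕ → K → List TapeSym) (T : ℕ) (hI : ∀ i ≤ l.length, I i k = l.drop i)
    (hp : ∀ i (hi : i < l.length),
      p.Does T ⟨some l[i], F i, update (I i) k (l.drop (i + 1))⟩ (F (i + 1)) (I (i + 1)))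
    (c : Option TapeSym) :
    (drain k p).Does (l.length * (T + 1) + 1) ⟨c, F 0, I 0⟩ (F l.length) (I l.length) := by
  -- The induction is on the number `m` of rounds still to come.
  suffices h : ∀ m i, i + m = l.length → ∀ c,
      (drain k p).Does (m * (T + 1) + 1) ⟨c, F i, I i⟩ (F l.length) (I l.length) from
    h l.length 0 (zero_add _) c
  intro m
  induction m with
  | zero =>
    rintro i hi c
    obtain rfl : i = l.length := hi
    exact ⟨1, by simp, none, Runs.drain_nil (s := ⟨c, F _, I _⟩) (by simpa using hI _ le_rfl)⟩
  | succ m ih =>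
    intro i hi c
    obtain ⟨t, ht, c', h⟩ := hp i (by omega)
    obtain ⟨t', ht', c'', h'⟩ := ih (i + 1) (by omega) c'
    refine ⟨1 + (t + t'), by linarith, c'', Runs.drain_cons (s := ⟨c, F i, I i⟩) ?_ h h'⟩
    exact (hI i (by omega)).trans (List.drop_eq_getElem_cons (by omega))

theorem does_drain_skip (k : K) (s : StackState K) :
    (drain k skip).Does ((s.stk k).length * 2 + 1) s s.flag (update s.stk k []) := by
  refine (does_drain (k := k) (p := skip) (fun _ => s.flag)
    (fun i => update s.stk k ((s.stk k).drop i)) 1 (fun i _ => update_self ..)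
    (fun i _ => (does_skip _).congr (hS := fun x => ?_)) s.cur).congr
      (hs := fun x => ?_) (hS := fun x => ?_)
  · grind [update_apply]
  · simp
  · simp

theorem does_drain_pushCur {k k' : K} (hk : k ≠ k') (s : StackState K) :
    (drain k (op (.pushCur k'))).Does ((s.stk k).length * 2 + 1) s s.flag
      (update (update s.stk k []) k' ((s.stk k).reverse ++ s.stk k')) := by
  refine (does_drain (k := k) (fun _ => s.flag)
    (fun i => update (update s.stk k' (((s.stk k).take i).reverse ++ s.stk k')) k
      ((s.stk k).drop i)) 1 (fun i _ => update_self ..)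
    (fun i hi => (does_op _ _).congr (hS := fun x => ?_)) s.cur).congr
      (hs := fun x => ?_) (hS := fun x => ?_)
  · simp only [StackOp.run, List.take_succ_eq_append_getElem hi, List.reverse_append,
      List.reverse_singleton, Option.toList_some, List.cons_append]
    grind [update_apply]
  · simp only [List.take_zero, List.reverse_nil, List.nil_append, List.drop_zero]
    grind [update_apply]
  · simp only [List.take_length, List.drop_length]
    grind [update_apply]

/-- Empty all stacks of a list. -/
def clear (l : List K) : StackProg K :=
  l.foldr (fun k p => seq (drain k skip) p) skip

theorem does_clear (l : List K) (B : ℕ) (s : StackState K) (hB : ∀ k, (s.stk k).length ≤ B) :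
    (clear l).Does (l.length * (B * 2 + 1) + 1) s s.flag
      (fun k => if k ∈ l then [] else s.stk k) := by
  induction l generalizing s with
  | nil => simpa [clear] using does_skip s
  | cons k l ih =>
    have h := Does.seq (does_drain_skip k s) (f' := s.flag)
      (S' := fun k' => if k' ∈ l then [] else update s.stk k [] k') (fun c =>
      ih ⟨c, s.flag, update s.stk k []⟩ fun k' => by
        by_cases h : k' = k
        · subst h; simp
        · simpa [h] using hB k')
    refine (h.congr (hS := fun k' => ?_)).mono ?_
    · by_cases h : k' = k
      · subst h; simp
      · simp [h]
    · have := hB k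
      rw [List.length_cons]
      linarith

/-- Push a symbol on all stacks of a list. -/
def pushAll (l : List K) : StackProg K :=
  l.foldr (fun k p => seq (op (.push k none)) p) skip

theorem does_pushAll (l : List K) (hl : l.Nodup) (s : StackState K) :
    (pushAll l).Does (l.length + 1) s s.flag
      (fun k => if k ∈ l then none :: s.stk k else s.stk k) := by
  induction l generalizing s with
  | nil => simpa [pushAll] using does_skip s
  | cons k l ih =>
    rw [List.nodup_cons] at hl
    refine ((does_op_seq (ih hl.2 _)).congr (hS := fun k' => ?_)).mono
      (T := 1 + (l.length + 1)) (by rw [List.length_cons]; omega)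
    simp only [StackOp.run, List.mem_cons]
    grind [update_apply]

/-- The unary representation of a number. -/
def unary (n : ℕ) : List TapeSym :=
  List.replicate n none

@[simp] theorem length_unary (n : ℕ) : (unary n).length = n :=
  List.length_replicate

theorem unary_succ (n : ℕ) : unary (n + 1) = none :: unary n :=
  List.replicate_succ

@[simp] theorem unary_zero : unary 0 = [] := rfl

theorem does_drain_unary {k : K} {p : StackProg K} {n : ℕ} (F : ℕ → Bool)
    (I : ℕ → K → List TapeSym) (T : ℕ) (hI : ∀ i ≤ n, I i k = unary (n - i))
    (hp : ∀ i < n,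
      p.Does T ⟨some none, F i, update (I i) k (unary (n - (i + 1)))⟩ (F (i + 1)) (I (i + 1)))
    (c : Option TapeSym) :
    (drain k p).Does (n * (T + 1) + 1) ⟨c, F 0, I 0⟩ (F n) (I n) := by
  have h := does_drain (k := k) (p := p) (l := unary n) F I T
    (fun i hi => by rw [hI i (by simpa using hi)]; simp [unary])
    (fun i hi => by
      have h := hp i (by simpa using hi)
      simpa [unary] using h) c
  rwa [length_unary] at h

/-- Add the height of the unary stack `r` to that of `t`, by way of the stack `b`. -/
def addTo (b r t : K) : StackProg K :=
  seq (drain r (seq (op (.push t none)) (op (.push b none)))) (drain b (op (.push r none)))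

/-- Reading `r` destroys it, so a copy is collected on `b` and moved back. The two loops cost 3 and
2 steps per round. -/
theorem does_addTo {b r t : K} (hbr : b ≠ r) (hbt : b ≠ t) (hrt : r ≠ t) {n v : ℕ}
    {s : StackState K} (hb : s.stk b = []) (hr : s.stk r = unary n) (ht : s.stk t = unary v) :
    (addTo b r t).Does (5 * n + 2) s s.flag (update s.stk t (unary (v + n))) := by
  have h₁ := does_drain_unary (k := r) (p := seq (op (.push t none)) (op (.push b none))) (n := n)
    (fun _ => s.flag)
    (fun i => update (update (update s.stk t (unary (v + i))) b (unary i)) r (unary (n - i)))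
    2 (by simp) (fun i hi => by
      refine (does_op_seq (does_op _ _)).congr (hS := fun x => ?_)
      simp only [StackOp.run, unary_succ, ← Nat.add_assoc]
      grind [update_apply]) s.cur
  have h₂ := does_drain_unary (k := b) (p := op (.push r none)) (n := n)
    (fun _ => s.flag)
    (fun i => update (update (update s.stk t (unary (v + n))) r (unary i)) b (unary (n - i)))
    1 (by simp) (fun i hi => by
      refine (does_op _ _).congr (hS := fun x => ?_)
      simp only [StackOp.run, unary_succ]
      grind [update_apply])
  refine ((h₁.congr (s' := s) (hs := fun x => ?_)).seq fun c =>
    (h₂ c).congr (hs := fun x => ?_) (hS := fun x => ?_)).mono (by omega)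
  all_goals
    simp only [unary_zero, Nat.add_zero, Nat.sub_zero, Nat.sub_self]
    grind [update_apply]

end StackProg

end

section

/-! ## First-order formulas over words and their evaluation by stack programs -/

open Function

/-- The stacks used to evaluate formulas: the word, its reversed prefix, two auxiliary stacks,
the values of two terms, and for each variable its value and its distance to the bound. -/
inductive EvalStack (ι : Type)
  | word
  | rev
  | scratch
  | count
  | fst
  | snd
  | lo (i : ι)
  | hi (i : ι)
  deriving DecidableEq, Fintype

/-- Terms over number variables. -/
inductive IdxTerm (ι : Type)
  | one
  | var (i : ι)
  | mul (i j : ι)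
  | add (s t : IdxTerm ι)

/-- First-order formulas on a word: `sym a t` says that the symbol with the index `t` is `a`, and
quantifiers range over the numbers below the length of the word. -/
inductive WordFormula (ι : Type)
  | sym (a : TapeSym) (t : IdxTerm ι)
  | le (s t : IdxTerm ι)
  | not (φ : WordFormula ι)
  | and (φ ψ : WordFormula ι)
  | all (i : ι) (φ : WordFormula ι)

variable {ι : Type} [DecidableEq ι]

/-! ### Evaluation of terms -/

namespace IdxTerm

open StackProg EvalStack

/-- The value of a term. -/
def val (e : ι → ℕ) : IdxTerm ι → ℕ
  | one => 1
  | var i => e i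
  | mul i j => e i * e j
  | add s t => s.val e + t.val e

/-- The program adding the value of a term to the unary stack `x`. -/
def prog (x : EvalStack ι) : IdxTerm ι → StackProg (EvalStack ι)
  | one => .op (.push x none)
  | var i => addTo scratch (lo i) x
  | mul i j => .seq (addTo scratch (lo i) count) (.drain count (addTo scratch (lo j) x))
  | add s t => .seq (s.prog x) (t.prog x)

/-- A bound for the running time of `IdxTerm.prog` in terms of a bound for the variables. -/
noncomputable def cost : IdxTerm ι → Polynomial ℕ
  | one => 1
  | var _ => 5 * .X + 2
  | mul _ _ => 5 * .X + 2 + (.X * (5 * .X + 3) + 1)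
  | add s t => s.cost + t.cost

/-- A bound for the value of a term in terms of a bound for the variables. -/
noncomputable def maxVal : IdxTerm ι → Polynomial ℕ
  | one => 1
  | var _ => .X
  | mul _ _ => .X * .X
  | add s t => s.maxVal + t.maxVal

omit [DecidableEq ι] in
theorem val_le (t : IdxTerm ι) {N : ℕ} {e : ι → ℕ} (he : ∀ i, e i ≤ N) :
    t.val e ≤ t.maxVal.eval N := by
  induction t with
  | one => simp [val, maxVal]
  | var i => simpa [val, maxVal] using he i
  | mul i j => simpa [val, maxVal] using Nat.mul_le_mul (he i) (he j)
  | add s t ihs iht => simpa [val, maxVal] using Nat.add_le_add ihs iht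

/-- A product is repeated addition: a copy of the first factor on `count` drives the loop that adds
the second one. The hypothesis `hx` keeps the target apart from the auxiliary stacks and from the
variables. -/
theorem does_prog (t : IdxTerm ι) {x : EvalStack ι} (hx : x = fst ∨ x = snd) {N : ℕ} {e : ι → ℕ}
    (he : ∀ i, e i ≤ N) {s : StackState (EvalStack ι)} (hscratch : s.stk scratch = [])
    (hcount : s.stk count = []) (hlo : ∀ i, s.stk (lo i) = unary (e i)) {v : ℕ}
    (hv : s.stk x = unary v) :
    (t.prog x).Does (t.cost.eval N) s s.flag (update s.stk x (unary (v + t.val e))) := by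
  have hx₁ : ∀ i, lo i ≠ x := by rintro i rfl; simp at hx
  have hx₂ : scratch ≠ x := by rintro rfl; simp at hx
  have hx₃ : count ≠ x := by rintro rfl; simp at hx
  have hx₄ : ∀ i : ι, lo i ≠ count := by simp
  induction t generalizing s v with
  | one =>
    refine ((does_op _ s).congr (hS := fun y => ?_)).mono (by simp [cost])
    simp only [StackOp.run, val, unary_succ, hv]
  | var i =>
    refine (does_addTo (by simp) hx₂ (hx₁ i) hscratch (hlo i) hv).mono ?_
    have := he i
    simp only [cost, Polynomial.eval_add, Polynomial.eval_mul, Polynomial.eval_ofNat,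
      Polynomial.eval_X]
    linarith
  | mul i j =>
    have h₁ := does_addTo (b := scratch) (r := lo i) (t := count) (v := 0) (by simp) (by simp)
      (by simp) hscratch (hlo i) hcount
    have h₂ := does_drain_unary (k := count) (p := addTo scratch (lo j) x) (n := e i)
      (fun _ => s.flag)
      (fun k => update (update s.stk count (unary (e i - k))) x (unary (v + k * e j)))
      (5 * e j + 2) (by grind [update_apply]) (fun k hk => by
        refine (does_addTo (n := e j) (v := v + k * e j) (by simp) hx₂ (hx₁ j) ?_ ?_ ?_).congr
          (hS := fun y => ?_)
        · grind [update_apply]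
        · grind [update_apply]
        · grind [update_apply]
        · simp only [Nat.add_mul, Nat.one_mul, ← Nat.add_assoc]
          grind [update_apply])
    refine (h₁.seq fun c => (h₂ c).congr (hs := fun y => ?_) (hS := fun y => ?_)).mono ?_
    · simp only [Nat.zero_mul, Nat.add_zero, Nat.sub_zero, Nat.zero_add, ← hv]
      grind [update_apply]
    · simp only [Nat.sub_self, unary_zero, val]
      grind [update_apply]
    · simp only [cost, Polynomial.eval_add, Polynomial.eval_mul, Polynomial.eval_ofNat,
        Polynomial.eval_X, Polynomial.eval_one]
      have h : e i * (5 * e j + 2 + 1) ≤ N * (5 * N + 3) :=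
        Nat.mul_le_mul (he i) (by have := he j; linarith)
      have := he i
      linarith
  | add s' t' ih₁ ih₂ =>
    refine ((ih₁ hscratch hcount hlo hv).seq fun c => (ih₂ (v := v + s'.val e)
      (s := ⟨c, s.flag, update s.stk x (unary (v + s'.val e))⟩) ?_ ?_ ?_ ?_).congr
        (hS := fun y => ?_)).mono (le_of_eq (by simp [cost]))
    · exact (update_of_ne hx₂ ..).trans hscratch
    · exact (update_of_ne hx₃ ..).trans hcount
    · exact fun i => (update_of_ne (hx₁ i) ..).trans (hlo i)
    · exact update_self ..
    · rw [update_idem, val, Nat.add_assoc]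

end IdxTerm

/-! ### Evaluation of formulas -/

namespace WordFormula

open StackProg EvalStack

/-- The truth of a formula on the word `w` under the valuation `e` of the variables. -/
def Holds (w : List TapeSym) : (ι → ℕ) → WordFormula ι → Prop
  | e, sym a t => w[t.val e]? = some a
  | e, le s t => s.val e ≤ t.val e
  | e, not φ => ¬ φ.Holds w e
  | e, and φ ψ => φ.Holds w e ∧ ψ.Holds w e
  | e, all i φ => ∀ v < w.length, φ.Holds w (update e i v)

/-- The bound variables of a formula. -/
def bound : WordFormula ι → Finset ι
  | sym _ _ => ∅
  | le _ _ => ∅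
  | not φ => φ.bound
  | and φ ψ => φ.bound ∪ ψ.bound
  | all i φ => insert i φ.bound

/-- No variable is bound in the scope of a quantifier of the same variable. -/
def WellScoped : WordFormula ι → Prop
  | sym _ _ => True
  | le _ _ => True
  | not φ => φ.WellScoped
  | and φ ψ => φ.WellScoped ∧ ψ.WellScoped
  | all i φ => i ∉ φ.bound ∧ φ.WellScoped

/-- The program setting the flag to the truth value of a formula. -/
def prog : WordFormula ι → StackProg (EvalStack ι)
  | sym a t => .seq (t.prog fst) <| .seq (.drain fst (.op (.move word rev))) <|
      .seq (.op (.peek word)) <| .seq (.op (.test fun c _ => c == some a)) <|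
      .drain rev (.op (.pushCur word))
  | le s t => .seq (s.prog fst) <| .seq (t.prog snd) <| .seq (.op (.test fun _ _ => true)) <|
      .seq (.drain fst (.seq (.op (.pop snd)) (.op (.test fun c f => f && c.isSome)))) <|
      .drain snd skip
  | not φ => .seq φ.prog (.op (.test fun _ f => !f))
  | and φ ψ => .seq φ.prog (.ite (fun _ f => f) ψ.prog skip)
  | all i φ => .seq (.op (.test fun _ _ => true)) <|
      .seq (.drain (hi i) (.seq (.ite (fun _ f => f) φ.prog skip) (.op (.push (lo i) none)))) <|
      .drain (lo i) (.op (.push (hi i) none))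

/-- A bound for the running time of `WordFormula.prog` in terms of the length of the word. -/
noncomputable def cost : WordFormula ι → Polynomial ℕ
  | sym _ t => t.cost + (t.maxVal * 2 + 1 + (1 + (1 + (t.maxVal * 2 + 1))))
  | le s t => s.cost + (t.cost + (1 + (s.maxVal * 3 + 1 + (t.maxVal * 2 + 1))))
  | not φ => φ.cost + 1
  | and φ ψ => φ.cost + (1 + (ψ.cost + 1))
  | all _ φ => 1 + (.X * (φ.cost + 4) + 1 + (.X * 2 + 1))

/-- The stacks hold the word and the valuation of the variables, and the other stacks needed for
the evaluation of `φ` are empty. -/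
structure Ready (φ : WordFormula ι) (w : List TapeSym) (e : ι → ℕ) (S : EvalStack ι → List TapeSym) :
    Prop where
  word : S word = w
  rev : S rev = []
  scratch : S scratch = []
  count : S count = []
  fst : S fst = []
  snd : S snd = []
  lo : ∀ i, S (lo i) = unary (e i)
  le : ∀ i, e i ≤ w.length
  eq_zero : ∀ i ∈ φ.bound, e i = 0
  hi : ∀ i ∈ φ.bound, S (hi i) = unary w.length

/-- The prefix of length `t.val e` is moved to `rev`, the symbol on top of `word` is inspected, and
the prefix is moved back. -/
theorem does_prog_sym (a : TapeSym) (t : IdxTerm ι) {w : List TapeSym} {e : ι → ℕ}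
    {s : StackState (EvalStack ι)} (h : (sym a t).Ready w e s.stk) :
    (sym a t).prog.Does ((sym a t).cost.eval w.length) s (w[t.val e]? == some a) s.stk := by
  obtain ⟨hword, hrev, hscratch, hcount, hfst, hsnd, hlo, hle, -, -⟩ := h
  have h₁ := t.does_prog (Or.inl rfl) hle hscratch hcount hlo (v := 0) hfst
  have h₂ := does_drain_unary (k := fst) (p := .op (.move word rev)) (n := t.val e)
    (fun _ => s.flag)
    (fun i => update (update (update s.stk word (w.drop i)) rev (w.take i).reverse) fst
      (unary (t.val e - i))) 1 (fun i _ => update_self ..)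
    (fun i hi => (does_op _ _).congr (hS := fun y => by
      -- This form also covers indices beyond the end of `w`, where `move` finds nothing and changes
      -- nothing.
      have h : (w.take (i + 1)).reverse = (w.drop i).head?.toList ++ (w.take i).reverse := by
        rw [List.take_add_one, List.reverse_append, List.head?_drop]
        cases w[i]? <;> rfl
      simp only [StackOp.run, h, ← List.tail_drop]
      grind [update_apply]))
  have hcost : (sym a t).cost.eval w.length = t.cost.eval w.length + (t.maxVal.eval w.length * 2
      + 1 + (1 + (1 + (t.maxVal.eval w.length * 2 + 1)))) := by simp [cost]
  have hval := t.val_le hle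
  rw [hcost]
  refine (h₁.seq fun c₁ => (((h₂ c₁).congr (hs := fun y => ?_)).mono (by omega)).seq fun c₂ =>
    does_op_seq (does_op_seq (((does_drain_pushCur (by simp) _).congr (hf' := ?_)
      (hS := fun y => ?_)).mono ?_)))
  · simp only [List.drop_zero, List.take_zero, List.reverse_nil, Nat.sub_zero, Nat.zero_add]
    grind [update_apply]
  · simp [StackOp.run]
  · have := List.take_append_drop (t.val e) w
    simp only [StackOp.run, Nat.sub_self, unary_zero]
    grind [update_apply]
  · simp only [StackOp.run]
    rw [update_of_ne (by simp), update_self, List.length_reverse, List.length_take]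
    omega

/-- Both values are counted down together; after `i` rounds the flag says that `snd` has not run out
before, that is, `i ≤ u.val e`. -/
theorem does_prog_le (t u : IdxTerm ι) {w : List TapeSym} {e : ι → ℕ}
    {s : StackState (EvalStack ι)} (h : (le t u).Ready w e s.stk) :
    (le t u).prog.Does ((le t u).cost.eval w.length) s (decide (t.val e ≤ u.val e)) s.stk := by
  obtain ⟨hword, hrev, hscratch, hcount, hfst, hsnd, hlo, hle, -, -⟩ := h
  have h₁ := t.does_prog (Or.inl rfl) hle hscratch hcount hlo (v := 0) hfst
  have h₂ := fun c => u.does_prog (x := snd) (Or.inr rfl) hle (v := 0)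
    (s := ⟨c, s.flag, update s.stk fst (unary (0 + t.val e))⟩)
    (by simpa using hscratch) (by simpa using hcount) (by simpa using hlo) (by simpa using hsnd)
  have h₃ := does_drain_unary (k := fst)
    (p := .seq (.op (.pop snd)) (.op (.test fun c f => f && c.isSome))) (n := t.val e)
    (fun i => decide (i ≤ u.val e))
    (fun i => update (update s.stk fst (unary (t.val e - i))) snd (unary (u.val e - i))) 2
    (fun i _ => by simp)
    (fun i hi => (does_op_seq (does_op _ _)).congr (hf' := by
        simp only [StackOp.run]
        rw [update_of_ne (by simp), update_self]
        by_cases h : i + 1 ≤ u.val e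
        · obtain ⟨m, hm⟩ : ∃ m, u.val e - i = m + 1 := ⟨u.val e - i - 1, by omega⟩
          simp [h, hm, unary_succ, show i ≤ u.val e by omega]
        · simp [h, show u.val e - i = 0 by omega])
      (hS := fun y => by
        have h : (unary (u.val e - i)).tail = unary (u.val e - (i + 1)) := by
          simp [unary, Nat.sub_add_eq]
        simp only [StackOp.run, ← h]
        grind [update_apply]))
  have hcost : (le t u).cost.eval w.length = t.cost.eval w.length + (u.cost.eval w.length + (1 +
      (t.maxVal.eval w.length * 3 + 1 + (u.maxVal.eval w.length * 2 + 1)))) := by simp [cost]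
  have hval := t.val_le hle
  have hval' := u.val_le hle
  rw [hcost]
  refine (h₁.seq fun c₁ => (h₂ c₁).seq fun c₂ => does_op_seq
    ((((h₃ c₂).congr (hf := ?_) (hs := fun y => ?_)).mono (by omega)).seq fun c₃ =>
      ((does_drain_skip snd _).congr (hS := fun y => ?_)).mono ?_))
  · simp [StackOp.run]
  · simp only [StackOp.run, Nat.sub_zero, Nat.zero_add]
  · simp only [Nat.sub_self, unary_zero]
    grind [update_apply]
  · simp only [update_self, length_unary]
    omega

-- A quantifier over `i` is a loop in which `lo i` counts up from zero while `hi i` counts down from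
-- the length of the word; afterwards `lo i` is poured back into `hi i`. Thus a bound variable must
-- start at zero with a full `hi i`, and `WellScoped` prevents the body from using the same two
-- stacks for a loop of its own. The cost multiplies by the length at each quantifier and hence
-- stays polynomial.
open Classical in
theorem does_prog (φ : WordFormula ι) (hφ : φ.WellScoped) {w : List TapeSym} {e : ι → ℕ}
    {s : StackState (EvalStack ι)} (h : φ.Ready w e s.stk) :
    φ.prog.Does (φ.cost.eval w.length) s (decide (φ.Holds w e)) s.stk := by
  induction φ generalizing e s with
  | sym a t =>
    refine (does_prog_sym a t h).congr (hf' := ?_)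
    simp only [Holds]
    by_cases h : w[t.val e]? = some a
    · simp [h]
    · simp [h]
  | le t u => exact (does_prog_le t u h).congr (hf' := by simp only [Holds]; congr)
  | not φ ih =>
    refine ((ih hφ ⟨h.word, h.rev, h.scratch, h.count, h.fst, h.snd, h.lo, h.le, h.eq_zero,
      h.hi⟩).seq fun c => (does_op _ _).congr (hf' := ?_)).mono (by simp [cost])
    by_cases hh : φ.Holds w e <;> simp [StackOp.run, Holds, hh]
  | and φ ψ ihφ ihψ =>
    have hφ' := ihφ hφ.1 ⟨h.word, h.rev, h.scratch, h.count, h.fst, h.snd, h.lo, h.le,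
      fun i hi => h.eq_zero i (Finset.mem_union_left _ hi),
      fun i hi => h.hi i (Finset.mem_union_left _ hi)⟩
    have hψ' := fun c f => ihψ hφ.2 (s := ⟨c, f, s.stk⟩) ⟨h.word, h.rev, h.scratch, h.count,
      h.fst, h.snd, h.lo, h.le,
      fun i hi => h.eq_zero i (Finset.mem_union_right _ hi),
      fun i hi => h.hi i (Finset.mem_union_right _ hi)⟩
    refine (hφ'.seq fun c => does_ite (T := ψ.cost.eval w.length + 1) (fun hc => ?_)
      fun hc => ?_).mono (by simp [cost])
    · refine ((hψ' c _).congr (hf' := ?_)).mono (by omega)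
      have : φ.Holds w e := by simpa using hc
      simp [Holds, this]
    · refine ((does_skip _).congr (hf' := ?_)).mono (by omega)
      have : ¬ φ.Holds w e := by simpa using hc
      simp [Holds, this]
  | all i φ ih =>
    have hi₀ : e i = 0 := h.eq_zero i (Finset.mem_insert_self ..)
    have hlo : s.stk (lo i) = [] := by rw [h.lo, hi₀, unary_zero]
    have hhi : s.stk (hi i) = unary w.length := h.hi i (Finset.mem_insert_self ..)
    -- After `k` rounds the flag is the conjunction of the instances below `k`. The body is skipped
    -- once the flag is `false`.
    have h₁ := does_drain_unary (k := hi i)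
      (p := .seq (.ite (fun _ f => f) φ.prog skip) (.op (.push (lo i) none))) (n := w.length)
      (fun k => decide (∀ v < k, φ.Holds w (update e i v)))
      (fun k => update (update s.stk (lo i) (unary k)) (hi i) (unary (w.length - k)))
      (φ.cost.eval w.length + 3) (fun k _ => update_self ..)
      (fun k hk => by
        have hφ' := fun c f => ih hφ.2 (e := update e i k) (s := ⟨c, f,
            update (update s.stk (lo i) (unary k)) (hi i) (unary (w.length - (k + 1)))⟩)
          ⟨by simpa using h.word, by simpa using h.rev, by simpa using h.scratch,
            by simpa using h.count, by simpa using h.fst, by simpa using h.snd,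
            fun j => by
              by_cases hj : j = i
              · subst hj; simp
              · simpa [hj] using h.lo j,
            fun j => by
              by_cases hj : j = i
              · subst hj; simpa using hk.le
              · simpa [hj] using h.le j,
            fun j hj => by
              have hji : j ≠ i := fun hji => hφ.1 (hji ▸ hj)
              simpa [hji] using h.eq_zero j (Finset.mem_insert_of_mem hj),
            fun j hj => by
              have hji : j ≠ i := fun hji => hφ.1 (hji ▸ hj)
              simpa [hji] using h.hi j (Finset.mem_insert_of_mem hj)⟩
        rw [update_idem]
        have hite : (StackProg.ite (fun _ f => f) φ.prog skip).Does
            (1 + (φ.cost.eval w.length + 1))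
            ⟨some none, decide (∀ v < k, φ.Holds w (update e i v)),
              update (update s.stk (lo i) (unary k)) (hi i) (unary (w.length - (k + 1)))⟩
            (decide (∀ v < k + 1, φ.Holds w (update e i v)))
            (update (update s.stk (lo i) (unary k)) (hi i) (unary (w.length - (k + 1)))) := by
          refine does_ite (fun hc => ?_) fun hc => ?_
          · refine ((hφ' _ _).congr (hf' := ?_)).mono (by omega)
            have hc' : ∀ v < k, φ.Holds w (update e i v) := by simpa using hc
            refine decide_eq_decide.mpr ⟨fun hk v hv => ?_, fun h => h k (Nat.lt_succ_self k)⟩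
            rcases Nat.lt_succ_iff_lt_or_eq.mp hv with hv | rfl
            · exact hc' v hv
            · exact hk
          · refine ((does_skip _).congr (hf' := ?_)).mono (by omega)
            have hc' : ¬ ∀ v < k, φ.Holds w (update e i v) := by simpa using hc
            have hc'' : ¬ ∀ v < k + 1, φ.Holds w (update e i v) := fun hv =>
              hc' fun v hvk => hv v (by omega)
            simp only [hc', hc'']
        refine (hite.seq fun c => (does_op _ _).congr (hS := fun y => ?_)).mono (by omega)
        simp only [StackOp.run, unary_succ]
        grind [update_apply])
    have h₂ := does_drain_unary (k := lo i) (p := .op (.push (hi i) none)) (n := w.length)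
      (fun _ => decide ((all i φ).Holds w e))
      (fun k => update (update s.stk (hi i) (unary k)) (lo i) (unary (w.length - k))) 1
      (fun k _ => update_self ..)
      (fun k hk => (does_op _ _).congr (hS := fun y => by
        simp only [StackOp.run, unary_succ]
        grind [update_apply]))
    refine (does_op_seq (Does.seq ((h₁ s.cur).congr (hf := ?_) (hs := fun y => ?_)) fun c =>
      (h₂ c).congr (hf := ?_) (hs := fun y => ?_) (hS := fun y => ?_))).mono ?_
    · simp [StackOp.run]
    · simp only [StackOp.run, unary_zero, Nat.sub_zero]
      grind [update_apply]
    · exact decide_eq_decide.mpr Iff.rfl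
    · simp only [Nat.sub_self, unary_zero]
      grind [update_apply]
    · simp only [Nat.sub_self, unary_zero]
      grind [update_apply]
    · simp [cost, Nat.add_assoc]

/-- The program deciding a sentence on the word on the stack `word`. -/
noncomputable def decider [Fintype ι] (φ : WordFormula ι) : StackProg (EvalStack ι) :=
  .seq (.drain word (.seq (.op (.pushCur rev)) (pushAll ((Finset.univ : Finset ι).toList.map hi))))
    <| .seq (.drain rev (.op (.pushCur word))) <| .seq φ.prog <|
      clear (Finset.univ : Finset (EvalStack ι)).toList

/-- A bound for the running time of `WordFormula.decider` in terms of the length of the word. -/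
noncomputable def deciderCost [Fintype ι] (φ : WordFormula ι) : Polynomial ℕ :=
  .X * (Polynomial.C (Fintype.card ι) + 3) + 1 + (.X * 2 + 1 + (φ.cost +
    (Polynomial.C (Fintype.card (EvalStack ι)) * (.X * 2 + 1) + 1)))

/-- The stacks before the evaluation of a formula, while the word is read. -/
def loading (w p : List TapeSym) (n : ℕ) : EvalStack ι → List TapeSym
  | word => w
  | rev => p
  | hi _ => unary n
  | _ => []

-- While the word is read, every `hi i` receives one mark per symbol, which provides the quantifier
-- bound in unary. Reading reverses the word onto `rev`, and a second pass restores its order. The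
-- final `clear` leaves the empty stacks that `StackProg.polyTime` requires.
open Classical in
theorem does_decider [Fintype ι] (φ : WordFormula ι) (hφ : φ.WellScoped) (w : List TapeSym) :
    φ.decider.Does (φ.deciderCost.eval w.length)
      (StackState.init word w) (decide (φ.Holds w fun _ => 0)) fun _ => [] := by
  have h₁ := does_drain (k := word) (l := w)
    (p := .seq (.op (.pushCur rev)) (pushAll ((Finset.univ : Finset ι).toList.map hi)))
    (fun _ => false)
    (fun k => loading (w.drop k) (w.take k).reverse k) (Fintype.card ι + 2) (fun _ _ => rfl)
    (fun k hk => by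
      refine ((does_op_seq (does_pushAll _ (Finset.univ.nodup_toList.map fun i j h => by
        simpa using h) _)).congr (hS := fun y => ?_)).mono (by simp; omega)
      have h : (w.take (k + 1)).reverse = w[k] :: (w.take k).reverse := by
        rw [List.take_succ_eq_append_getElem hk, List.reverse_append, List.reverse_singleton]
        rfl
      cases y <;> simp [StackOp.run, loading, unary_succ, h])
  have h₂ : ∀ c, (StackProg.drain rev (.op (.pushCur word))).Does (w.length * 2 + 1)
      ⟨c, false, loading (ι := ι) (w.drop w.length) (w.take w.length).reverse w.length⟩ false
      (loading w [] w.length) := fun c => by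
    refine ((does_drain_pushCur (by simp) _).congr (hS := fun y => ?_)).mono (by simp [loading])
    cases y <;> simp [loading]
  have h₃ := fun c => φ.does_prog hφ (s := ⟨c, false, loading w [] w.length⟩) (e := fun _ => 0) (w := w)
    ⟨rfl, rfl, rfl, rfl, rfl, rfl, fun _ => rfl, by simp, by simp, fun _ _ => rfl⟩
  have h₄ := fun c => does_clear (Finset.univ : Finset (EvalStack ι)).toList w.length
    ⟨c, decide (φ.Holds w fun _ => 0), loading w [] w.length⟩ fun y => by cases y <;> simp [loading]
  refine ((h₁ none).congr (hs := fun y => ?_) |>.seq fun c₁ =>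
    (h₂ c₁).seq fun c₂ => (h₃ c₂).seq fun c₃ => (h₄ c₃).congr (hS := fun y => ?_)).mono ?_
  · cases y <;> simp [StackState.init, loading]
  · simp
  · simp [deciderCost, Nat.add_assoc]

theorem polyTimeDecidable [Fintype ι] (φ : WordFormula ι) (hφ : φ.WellScoped) :
    PolyTimeDecidable₃ fun x u v => φ.Holds (encodeTriple (x, u, v)) fun _ => 0 := by
  classical
  refine ⟨fun a => decide (φ.Holds (encodeTriple a) fun _ => 0), fun x u v => by simp,
    φ.decider.polyTime word _ φ.deciderCost fun a => ?_⟩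
  obtain ⟨t, ht, c, h⟩ := φ.does_decider hφ (encodeTriple a)
  exact ⟨t, ht, c, h⟩

end WordFormula

end

/-! ### Cliques and achromatic numbers in terms of pairs of vertices -/

namespace TwoEdgeColoredGraph

variable {V W : Type}

theorem adj_of_mem_neg {G : TwoEdgeColoredGraph V} {u v : V} (h : s(u, v) ∈ G.neg) :
    G.graph.Adj u v :=
  G.neg_subset h

/-! ### Quotients and cliques -/

/-- The image of a 2-edge-coloured graph under a map that is injective on edges and compatible
with signs. -/
def image (G : TwoEdgeColoredGraph V) (f : V → W) (hf : ∀ u v, G.graph.Adj u v → f u ≠ f v) :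
    TwoEdgeColoredGraph W where
  graph :=
    { Adj := fun x y => ∃ u v, G.graph.Adj u v ∧ f u = x ∧ f v = y
      symm := ⟨fun _ _ ⟨u, v, h, hu, hv⟩ => ⟨v, u, h.symm, hv, hu⟩⟩
      loopless := ⟨fun _ ⟨u, v, h, hu, hv⟩ => hf u v h (hu.trans hv.symm)⟩ }
  neg := {e | ∃ u v, s(u, v) ∈ G.neg ∧ e = s(f u, f v)}
  neg_subset := by
    rintro _ ⟨u, v, h, rfl⟩
    exact ⟨u, v, adj_of_mem_neg h, rfl, rfl⟩

theorem isSurjHom_image (G : TwoEdgeColoredGraph V) (f : V → W)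
    (hf : ∀ u v, G.graph.Adj u v → f u ≠ f v) (hsurj : Function.Surjective f)
    (hsign : ∀ u v u' v', G.graph.Adj u v → G.graph.Adj u' v' → f u = f u' → f v = f v' →
      s(u, v) ∈ G.neg → s(u', v') ∈ G.neg) :
    IsSurjHom f G (G.image f hf) := by
  refine ⟨fun u v h => ⟨⟨u, v, h, rfl, rfl⟩, fun hn => ⟨u, v, hn, rfl⟩, ?_⟩, hsurj,
    fun x y h => h⟩
  rintro ⟨u', v', hn, he⟩
  rcases Sym2.eq_iff.mp he with ⟨hu, hv⟩ | ⟨hu, hv⟩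
  · exact hsign u' v' u v (adj_of_mem_neg hn) h hu.symm hv.symm hn
  · refine hsign v' u' u v (adj_of_mem_neg hn).symm h hu.symm hv.symm ?_
    rwa [Sym2.eq_swap]

/-- Two vertices that are adjacent or joined by a path of length two with edges of different
signs. -/
def Linked (G : TwoEdgeColoredGraph V) (a b : V) : Prop :=
  G.graph.Adj a b ∨
    ∃ c, G.graph.Adj a c ∧ G.graph.Adj b c ∧ ¬ (s(a, c) ∈ G.neg ↔ s(b, c) ∈ G.neg)

/-- Two vertices that are not linked can be identified. -/
theorem exists_mapsOnto_of_not_linked (G : TwoEdgeColoredGraph V) {a b : V} (hab : a ≠ b)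
    (h : ¬ G.Linked a b) : ∃ H : TwoEdgeColoredGraph {v : V // v ≠ b}, G.MapsOnto H := by
  classical
  let f : V → {v : V // v ≠ b} := fun v => if hv : v = b then ⟨a, hab⟩ else ⟨v, hv⟩
  have hadj : ¬ G.graph.Adj a b := fun hadj => h (Or.inl hadj)
  have hsgn : ∀ c, G.graph.Adj a c → G.graph.Adj b c → (s(a, c) ∈ G.neg ↔ s(b, c) ∈ G.neg) := by
    intro c hac hbc
    by_contra hc
    exact h (Or.inr ⟨c, hac, hbc, hc⟩)
  have hf : ∀ u v, f u = f v → u = v ∨ (u = a ∧ v = b) ∨ (u = b ∧ v = a) := by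
    intro u v
    by_cases hu : u = b <;> by_cases hv : v = b <;> (simp [f, hu, hv, Subtype.ext_iff]; try tauto)
  have hf' : ∀ u v, G.graph.Adj u v → f u ≠ f v := by
    intro u v huv he
    rcases hf u v he with rfl | ⟨rfl, rfl⟩ | ⟨rfl, rfl⟩
    · exact huv.ne rfl
    · exact hadj huv
    · exact hadj huv.symm
  refine ⟨G.image f hf', f, G.isSurjHom_image f hf' (fun v => ⟨v.1, by simp [f, v.2]⟩) ?_⟩
  -- Edges with a common end and the same image have the same sign, as `a` and `b` agree on their
  -- common neighbours.
  have key : ∀ u v v', G.graph.Adj u v → G.graph.Adj u v' → f v = f v' →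
      (s(u, v) ∈ G.neg ↔ s(u, v') ∈ G.neg) := by
    intro u v v' huv huv' he
    rcases hf v v' he with rfl | ⟨rfl, rfl⟩ | ⟨rfl, rfl⟩
    · rfl
    · simpa only [Sym2.eq_swap] using hsgn u huv.symm huv'.symm
    · simpa only [Sym2.eq_swap] using (hsgn u huv'.symm huv.symm).symm
  intro u v u' v' huv huv' hu hv hn
  rcases hf u u' hu with rfl | hu'
  · exact (key u v v' huv huv' hv).mp hn
  rcases hf v v' hv with rfl | hv'
  · rw [Sym2.eq_swap] at hn ⊢
    exact (key v u u' huv.symm huv'.symm hu).mp hn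
  -- If the edges differ at both ends, all their ends lie in `{a, b}`; such an edge would be a loop
  -- or join `a` to `b`.
  rcases hu' with ⟨rfl, rfl⟩ | ⟨rfl, rfl⟩ <;> rcases hv' with ⟨rfl, rfl⟩ | ⟨rfl, rfl⟩ <;>
    first
    | exact absurd huv (G.graph.loopless.irrefl _)
    | exact absurd huv hadj
    | exact absurd huv.symm hadj

theorem not_nonempty_equiv_ne [Finite V] (b : V) : ¬ Nonempty (V ≃ {v : V // v ≠ b}) := by
  rintro ⟨e⟩
  have h : Function.Injective fun v => (e v).1 := Subtype.val_injective.comp e.injective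
  obtain ⟨v, hv⟩ := Finite.surjective_of_injective h b
  exact (e v).2 hv

/-- Surjectivity on edges is what makes the inverse of a bijective homomorphism a homomorphism. -/
theorem IsSurjHom.isHom_symm {φ : V ≃ W} {G : TwoEdgeColoredGraph V} {H : TwoEdgeColoredGraph W}
    (h : IsSurjHom φ G H) : IsHom φ.symm H G := by
  intro x y hxy
  obtain ⟨u, v, huv, rfl, rfl⟩ := h.2.2 x y hxy
  simpa [huv] using (h.1 u v huv).2.symm

/-- Identifying two vertices that are not linked gives an image of smaller order, as `V` is finite.
Linked vertices never have the same image, since this would create a loop or an edge of both signs;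
so if all pairs are linked, every surjective homomorphism is bijective. -/
theorem isClique_iff [Finite V] (G : TwoEdgeColoredGraph V) :
    G.IsClique ↔ ∀ a b, a ≠ b → G.Linked a b := by
  constructor
  · intro h a b hab
    by_contra hl
    obtain ⟨H, hH⟩ := G.exists_mapsOnto_of_not_linked hab hl
    obtain ⟨e, -⟩ := h _ H hH
    exact not_nonempty_equiv_ne b ⟨e⟩
  · rintro h W H ⟨φ, hφ⟩
    have hinj : Function.Injective φ := by
      intro a b hab
      by_contra hne
      rcases h a b hne with hadj | ⟨c, hac, hbc, hc⟩
      · exact (hφ.1 a b hadj).1.ne hab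
      · exact hc (by rw [(hφ.1 a c hac).2, (hφ.1 b c hbc).2, hab])
    let e := Equiv.ofBijective φ ⟨hinj, hφ.2.1⟩
    have he : IsSurjHom e G H := hφ
    exact ⟨e, he.1, he.isHom_symm⟩

/-! ### Switching -/

/-- Re-signing at all vertices of a set: the signs of the edges leaving the set are inverted. -/
def switch (G : TwoEdgeColoredGraph V) (s : Set V) : TwoEdgeColoredGraph V where
  graph := G.graph
  neg := {e | ∃ u v, G.graph.Adj u v ∧ e = s(u, v) ∧ (s(u, v) ∈ G.neg ↔ (u ∈ s ↔ v ∈ s))}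
  neg_subset := by
    rintro _ ⟨u, v, h, rfl, -⟩
    exact h

@[simp] theorem graph_switch (G : TwoEdgeColoredGraph V) (s : Set V) :
    (G.switch s).graph = G.graph := rfl

theorem mem_neg_switch (G : TwoEdgeColoredGraph V) (s : Set V) (u v : V) :
    s(u, v) ∈ (G.switch s).neg ↔ G.graph.Adj u v ∧ (s(u, v) ∈ G.neg ↔ (u ∈ s ↔ v ∈ s)) := by
  constructor
  · rintro ⟨u', v', h, he, hs⟩
    rcases Sym2.eq_iff.mp he with ⟨rfl, rfl⟩ | ⟨rfl, rfl⟩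
    · exact ⟨h, hs⟩
    · rw [Sym2.eq_swap]
      exact ⟨h.symm, by tauto⟩
  · rintro ⟨h, hs⟩
    exact ⟨u, v, h, rfl, hs⟩

theorem ext_neg {G H : TwoEdgeColoredGraph V} (hg : G.graph = H.graph)
    (hn : ∀ u v, G.graph.Adj u v → (s(u, v) ∈ G.neg ↔ s(u, v) ∈ H.neg)) : G = H := by
  refine TwoEdgeColoredGraph.ext hg (Set.ext fun e => ?_)
  induction e with
  | _ u v =>
    by_cases h : G.graph.Adj u v
    · exact hn u v h
    · exact ⟨fun h' => absurd (adj_of_mem_neg h') h, fun h' => absurd (hg ▸ adj_of_mem_neg h') h⟩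

theorem mem_neg_resign (G : TwoEdgeColoredGraph V) (w u v : V) (h : G.graph.Adj u v) :
    s(u, v) ∈ (G.resign w).neg ↔ ((s(u, v) ∈ G.neg) ↔ (u = w ↔ v = w)) := by
  have hne := h.ne
  simp only [resign, Set.mem_ofPred_eq, SimpleGraph.mem_edgeSet, Sym2.mem_iff, h, true_and]
  have h₁ : w = u ↔ u = w := eq_comm
  have h₂ : w = v ↔ v = w := eq_comm
  have h₃ : ¬ (u = w ∧ v = w) := fun h => hne (h.1.trans h.2.symm)
  tauto

/-- Signs are parities: a second re-signing at `w` cancels the first, hence the symmetric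
difference. -/
theorem resign_switch (G : TwoEdgeColoredGraph V) (s : Set V) (w : V) :
    (G.switch s).resign w = G.switch (symmDiff s {w}) := by
  refine ext_neg rfl fun u v h => ?_
  have h' : G.graph.Adj u v := h
  rw [mem_neg_resign (G.switch s) w u v h, mem_neg_switch, mem_neg_switch]
  simp only [h', true_and, Set.mem_symmDiff, Set.mem_singleton_iff]
  tauto

theorem switch_empty (G : TwoEdgeColoredGraph V) : G.switch ∅ = G :=
  ext_neg rfl fun u v h => by
    have h' : G.graph.Adj u v := h
    simp [mem_neg_switch, h']

/-- Only the set of the vertices re-signed an odd number of times matters. Finiteness allows every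
set to be reached by a series of re-signings. -/
theorem equivalent_iff [Finite V] {G H : TwoEdgeColoredGraph V} :
    Equivalent G H ↔ ∃ s, H = G.switch s := by
  constructor
  · intro h
    induction h with
    | refl => exact ⟨∅, G.switch_empty.symm⟩
    | tail _ h ih =>
      obtain ⟨s, rfl⟩ := ih
      obtain ⟨v, rfl⟩ := h
      exact ⟨_, G.resign_switch s v⟩
  · rintro ⟨s, rfl⟩
    induction s, s.toFinite using Set.Finite.induction_on with
    | empty => rw [switch_empty]; exact Relation.ReflTransGen.refl
    | @insert v s hv _ ih =>
      refine Relation.ReflTransGen.tail ih ⟨v, ?_⟩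
      rw [resign_switch]
      congr 1
      ext x
      simp only [Set.mem_insert_iff, Set.mem_symmDiff, Set.mem_singleton_iff]
      by_cases hx : x = v
      · subst hx; simp [hv]
      · simp [hx]

theorem toSigned_eq_iff [Finite V] {G H : TwoEdgeColoredGraph V} :
    H.toSigned = G.toSigned ↔ ∃ s, H = G.switch s := by
  rw [← equivalent_iff, eq_comm]
  exact Quotient.eq (r := resignSetoid V)

/-! ### Signed cliques -/

/-- Two vertices that are adjacent or opposite in a cycle of length four with an odd number of
negative edges. -/
def SignLinked (G : TwoEdgeColoredGraph V) (a b : V) : Prop :=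
  G.graph.Adj a b ∨ ∃ c d, (G.graph.Adj a c ∧ G.graph.Adj b c) ∧
    (G.graph.Adj a d ∧ G.graph.Adj b d) ∧
      ¬ ((s(a, c) ∈ G.neg ↔ s(b, c) ∈ G.neg) ↔ (s(a, d) ∈ G.neg ↔ s(b, d) ∈ G.neg))

theorem SignLinked.switch {G : TwoEdgeColoredGraph V} {a b : V} (h : G.SignLinked a b)
    (s : Set V) : (G.switch s).SignLinked a b := by
  rcases h with h | ⟨c, d, hc, hd, h⟩
  · exact Or.inl h
  · refine Or.inr ⟨c, d, hc, hd, ?_⟩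
    -- Whether the signs at `a` and `b` towards a common neighbour `x` agree is changed by a
    -- switching exactly if it separates `a` from `b`. This does not depend on `x`, so comparing two
    -- common neighbours is invariant.
    have key : ∀ x, G.graph.Adj a x ∧ G.graph.Adj b x →
        ((s(a, x) ∈ (G.switch s).neg ↔ s(b, x) ∈ (G.switch s).neg) ↔
          ((s(a, x) ∈ G.neg ↔ s(b, x) ∈ G.neg) ↔ (a ∈ s ↔ b ∈ s))) := by
      intro x hx
      simp only [mem_neg_switch, hx, true_and]
      clear h hc hd hx
      tauto
    rw [key c hc, key d hd]
    clear hc hd key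
    tauto

/-- Without an odd 4-cycle through `a` and `b` as opposite vertices, either all common neighbours
see equal signs or all see different signs. In the second case switching at `b` makes them equal. -/
theorem exists_switch_not_linked {G : TwoEdgeColoredGraph V} {a b : V} (h : ¬ G.SignLinked a b) :
    ∃ s, ¬ (G.switch s).Linked a b := by
  have hadj : ¬ G.graph.Adj a b := fun hadj => h (Or.inl hadj)
  by_cases hs : ∃ c, G.graph.Adj a c ∧ G.graph.Adj b c ∧ ¬ (s(a, c) ∈ G.neg ↔ s(b, c) ∈ G.neg)
  · obtain ⟨c, hac, hbc, hc⟩ := hs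
    refine ⟨{b}, ?_⟩
    rintro (hl | ⟨d, had, hbd, hd⟩)
    · exact hadj hl
    · simp only [graph_switch] at had hbd
      have hab : a ≠ b := by
        rintro rfl
        exact hc Iff.rfl
      have hdb : d ≠ b := hbd.ne'
      simp only [mem_neg_switch, had, hbd, true_and, Set.mem_singleton_iff, hab, hdb] at hd
      refine h (Or.inr ⟨c, d, ⟨hac, hbc⟩, ⟨had, hbd⟩, ?_⟩)
      tauto
  · refine ⟨∅, ?_⟩
    rw [switch_empty]
    rintro (hl | hl)
    · exact hadj hl
    · exact hs hl

/-- The argument of `isClique_iff` after switching: a pair that is not sign-linked becomes unlinked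
in some representative and can be identified there, while a sign-linked pair stays so in all of them
and is never identified. -/
theorem toSigned_isClique_iff [Finite V] (G : TwoEdgeColoredGraph V) :
    G.toSigned.IsClique ↔ ∀ a b, a ≠ b → G.SignLinked a b := by
  constructor
  · intro h a b hab
    by_contra hl
    obtain ⟨s, hs⟩ := exists_switch_not_linked hl
    obtain ⟨H, hH⟩ := (G.switch s).exists_mapsOnto_of_not_linked hab hs
    obtain ⟨e, -⟩ := h _ H.toSigned ⟨_, _, toSigned_eq_iff.mpr ⟨s, rfl⟩, rfl, hH⟩
    exact not_nonempty_equiv_ne b ⟨e⟩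
  · rintro h W T ⟨G', H, hG, rfl, φ, hφ⟩
    obtain ⟨s, rfl⟩ := toSigned_eq_iff.mp hG
    have hinj : Function.Injective φ := by
      intro a b hab
      by_contra hne
      rcases (h a b hne).switch s with hadj | ⟨c, d, ⟨hac, hbc⟩, ⟨had, hbd⟩, hc⟩
      · exact (hφ.1 a b hadj).1.ne hab
      · exact hc (by rw [(hφ.1 a c hac).2, (hφ.1 b c hbc).2, (hφ.1 a d had).2, (hφ.1 b d hbd).2,
          hab, iff_self, iff_self])
    let e := Equiv.ofBijective φ ⟨hinj, hφ.2.1⟩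
    have he : IsSurjHom e (G.switch s) H := hφ
    exact ⟨e, ⟨_, _, hG, rfl, he.1⟩, ⟨_, _, rfl, hG, he.isHom_symm⟩⟩

/-! ### Lower bounds for achromatic numbers -/

/-- `G` maps onto a 2-edge-coloured graph of order `m`, any two vertices of which are linked. -/
def HasLinkedImage (G : TwoEdgeColoredGraph V) (m : ℕ) : Prop :=
  ∃ (K : TwoEdgeColoredGraph (Fin m)) (φ : V → Fin m), IsSurjHom φ G K ∧
    ∀ a b, a ≠ b → K.Linked a b

/-- `G` maps onto a 2-edge-coloured graph of order `m`, any two vertices of which are linked in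
the corresponding signed graph. -/
def HasSignLinkedImage (G : TwoEdgeColoredGraph V) (m : ℕ) : Prop :=
  ∃ (K : TwoEdgeColoredGraph (Fin m)) (φ : V → Fin m), IsSurjHom φ G K ∧
    ∀ a b, a ≠ b → K.SignLinked a b

/-- A nonempty bounded set attains its supremum. Since `sSup ∅ = 0`, the empty set only matters for
`k ≤ 0`, which is listed separately. -/
theorem intCast_le_sSup_iff {S : Set ℕ} (hS : BddAbove S) (k : ℤ) :
    k ≤ (sSup S : ℕ) ↔ k ≤ 0 ∨ ∃ m ∈ S, k ≤ m := by
  constructor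
  · intro h
    by_cases hk : k ≤ 0
    · exact Or.inl hk
    · rcases S.eq_empty_or_nonempty with rfl | hne
      · simp at h
        exact absurd h hk
      · exact Or.inr ⟨_, Nat.sSup_mem hne hS, h⟩
  · rintro (h | ⟨m, hm, h⟩)
    · exact h.trans (by positivity)
    · exact h.trans (by exact_mod_cast le_csSup hS hm)

/-- The witness `a` excludes the default value `sInf ∅ = 0`. -/
theorem intCast_le_sInf_iff {α : Type} {p : α → Prop} (f : α → ℕ) {a : α} (ha : p a) (k : ℤ) :
    k ≤ (sInf {m | ∃ a, p a ∧ f a = m} : ℕ) ↔ ∀ a, p a → k ≤ f a := by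
  constructor
  · intro h a ha
    have hle : sInf {m | ∃ a, p a ∧ f a = m} ≤ f a := Nat.sInf_le ⟨a, ha, rfl⟩
    exact h.trans (by exact_mod_cast hle)
  · intro h
    obtain ⟨a, ha, hm⟩ := Nat.sInf_mem (s := {m | ∃ a, p a ∧ f a = m}) ⟨f a, a, ha, rfl⟩
    rw [← hm]
    exact h a ha

theorem le_of_surjective {n m : ℕ} {φ : Fin n → Fin m} (h : Function.Surjective φ) : m ≤ n := by
  simpa using Fintype.card_le_of_surjective φ h

variable {n : ℕ}

theorem le_achromaticNumber_iff (G : TwoEdgeColoredGraph (Fin n)) (k : ℤ) :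
    k ≤ G.achromaticNumber ↔ k ≤ 0 ∨ ∃ m : ℕ, k ≤ m ∧ G.HasLinkedImage m := by
  rw [achromaticNumber, intCast_le_sSup_iff ⟨n, ?_⟩]
  · refine or_congr Iff.rfl (exists_congr fun m => ?_)
    rw [and_comm]
    refine and_congr Iff.rfl ⟨?_, ?_⟩
    · rintro ⟨K, hK, φ, hφ⟩
      exact ⟨K, φ, hφ, K.isClique_iff.mp hK⟩
    · rintro ⟨K, φ, hφ, hK⟩
      exact ⟨K, K.isClique_iff.mpr hK, φ, hφ⟩
  · rintro m ⟨K, -, φ, hφ⟩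
    exact le_of_surjective hφ.2.1

theorem le_toSigned_achromaticNumber_iff (G : TwoEdgeColoredGraph (Fin n)) (k : ℤ) :
    k ≤ G.toSigned.achromaticNumber ↔
      k ≤ 0 ∨ ∃ m : ℕ, k ≤ m ∧ ∃ s, (G.switch s).HasSignLinkedImage m := by
  rw [SignedGraph.achromaticNumber, intCast_le_sSup_iff ⟨n, ?_⟩]
  · refine or_congr Iff.rfl (exists_congr fun m => ?_)
    rw [and_comm]
    refine and_congr Iff.rfl ⟨?_, ?_⟩
    · rintro ⟨_, hK, G', K, hG, rfl, φ, hφ⟩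
      obtain ⟨s, rfl⟩ := toSigned_eq_iff.mp hG
      exact ⟨s, K, φ, hφ, K.toSigned_isClique_iff.mp hK⟩
    · rintro ⟨s, K, φ, hφ, hK⟩
      exact ⟨K.toSigned, K.toSigned_isClique_iff.mpr hK, _, _, toSigned_eq_iff.mpr ⟨s, rfl⟩, rfl,
        φ, hφ⟩
  · rintro m ⟨K, -, G', K', -, -, φ, hφ⟩
    exact le_of_surjective hφ.2.1

theorem le_minAchromaticNumber_iff (G : TwoEdgeColoredGraph (Fin n)) (k : ℤ) :
    k ≤ G.toSigned.minAchromaticNumber ↔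
      ∀ s, k ≤ 0 ∨ ∃ m : ℕ, k ≤ m ∧ (G.switch s).HasLinkedImage m := by
  simp only [← le_achromaticNumber_iff]
  refine (intCast_le_sInf_iff (p := fun G' => G'.toSigned = G.toSigned) achromaticNumber (a := G) rfl
    k).trans ⟨?_, ?_⟩
  · exact fun h s => h _ (toSigned_eq_iff.mpr ⟨s, rfl⟩)
  · intro h G' hG
    obtain ⟨s, rfl⟩ := toSigned_eq_iff.mp hG
    exact h s

/-- The 2-edge-coloured graph on a given graph with no negative edges. -/
def allPositive (G : SimpleGraph V) : TwoEdgeColoredGraph V :=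
  ⟨G, ∅, Set.empty_subset _⟩

theorem le_min2ecAchromaticNumber_iff (G : SimpleGraph (Fin n)) (k : ℤ) :
    k ≤ min2ecAchromaticNumber G ↔ ∀ C : TwoEdgeColoredGraph (Fin n), C.graph = G →
      (k ≤ 0 ∨ ∃ m : ℕ, k ≤ m ∧ C.HasLinkedImage m) := by
  simp only [← le_achromaticNumber_iff]
  exact intCast_le_sInf_iff (p := fun C => C.graph = G) achromaticNumber (a := allPositive G) rfl k

theorem le_minSignedAchromaticNumber_iff (G : SimpleGraph (Fin n)) (k : ℤ) :
    k ≤ minSignedAchromaticNumber G ↔ ∀ C : TwoEdgeColoredGraph (Fin n), C.graph = G →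
      (k ≤ 0 ∨ ∃ m : ℕ, k ≤ m ∧ ∃ s, (C.switch s).HasSignLinkedImage m) := by
  simp only [← le_toSigned_achromaticNumber_iff]
  exact intCast_le_sInf_iff (p := fun C => C.graph = G) (fun C => C.toSigned.achromaticNumber)
    (a := allPositive G) rfl k

end TwoEdgeColoredGraph

section

open Function

/-! ## Decoding of instances -/

section Integers

open Computability

/-- The value of a list of binary digits, the least significant digit first. -/
def bitsVal : List Bool → ℕ
  | [] => 0
  | b :: l => 2 * bitsVal l + b.toNat

theorem bitsVal_encodePosNum (p : PosNum) : bitsVal (encodePosNum p) = p := by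
  induction p with
  | one => rfl
  | bit0 p ih => simp [encodePosNum, bitsVal, ih, PosNum.cast_bit0, two_mul]
  | bit1 p ih => simp [encodePosNum, bitsVal, ih, PosNum.cast_bit1, two_mul]

theorem bitsVal_encodeNat (k : ℕ) : bitsVal (encodeNat k) = k := by
  have h : ((k : Num) : ℕ) = k := Num.to_of_nat k
  rw [encodeNat]
  cases hk : (k : Num) with
  | zero =>
    rw [hk] at h
    simpa [encodeNum, bitsVal] using h
  | pos p =>
    rw [hk] at h
    rw [encodeNum, bitsVal_encodePosNum]
    exact h

theorem getLast?_encodePosNum (p : PosNum) : (encodePosNum p).getLast? = some true := by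
  induction p with
  | one => rfl
  | bit0 p ih => simp [encodePosNum, List.getLast?_cons, ih]
  | bit1 p ih => simp [encodePosNum, List.getLast?_cons, ih]

theorem encodeNat_eq_nil_or (k : ℕ) : encodeNat k = [] ∨ (encodeNat k).getLast? = some true := by
  rw [encodeNat]
  cases (k : Num) with
  | zero => exact Or.inl rfl
  | pos p => exact Or.inr (getLast?_encodePosNum p)

theorem exists_encodePosNum (l : List Bool) (h : l.getLast? = some true) :
    ∃ p, encodePosNum p = l := by
  induction l with
  | nil => simp at h
  | cons b l ih =>
    rcases eq_or_ne l [] with rfl | hl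
    · obtain rfl : b = true := by simpa using h
      exact ⟨PosNum.one, rfl⟩
    · obtain ⟨p, rfl⟩ := ih (by
        obtain ⟨c, l', rfl⟩ := List.exists_cons_of_ne_nil hl
        simpa [List.getLast?_cons_cons] using h)
      cases b
      · exact ⟨p.bit0, rfl⟩
      · exact ⟨p.bit1, rfl⟩

theorem exists_encodeNat (l : List Bool) (h : l.getLast? = some true) :
    ∃ k, k ≠ 0 ∧ encodeNat k = l := by
  obtain ⟨p, rfl⟩ := exists_encodePosNum l h
  refine ⟨p, (PosNum.to_nat_pos p).ne', ?_⟩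
  rw [encodeNat, PosNum.of_to_nat, encodeNum]

/-- The digits start with the least significant one, so a nonempty digit word is a code exactly if
it ends in `true`. The empty word is zero, whose sign bit can only be `false`. -/
theorem exists_encodeInteger_iff (b : Bool) (l : List Bool) :
    (∃ k : ℤ, b :: l = encodeInteger k) ↔ (l = [] ∧ b = false) ∨ l.getLast? = some true := by
  constructor
  · rintro ⟨k, hk⟩
    rw [encodeInteger, List.cons.injEq] at hk
    rcases encodeNat_eq_nil_or k.natAbs with h | h
    · refine Or.inl ⟨hk.2.trans h, ?_⟩
      have h0 := bitsVal_encodeNat k.natAbs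
      rw [h] at h0
      have : k = 0 := by simpa [bitsVal, eq_comm] using h0
      simp [hk.1, this]
    · exact Or.inr (hk.2 ▸ h)
  · rintro (⟨rfl, rfl⟩ | h)
    · exact ⟨0, rfl⟩
    · obtain ⟨k, hk, rfl⟩ := exists_encodeNat l h
      cases b
      · exact ⟨k, by simp [encodeInteger]⟩
      · exact ⟨-k, by simp [encodeInteger]; omega⟩

theorem nonpos_iff_of_eq_encodeInteger {b : Bool} {l : List Bool} {k : ℤ}
    (h : b :: l = encodeInteger k) : k ≤ 0 ↔ b = true ∨ l = [] := by
  rw [encodeInteger, List.cons.injEq] at h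
  obtain ⟨rfl, rfl⟩ := h
  have hv := bitsVal_encodeNat k.natAbs
  constructor
  · intro hk
    rcases hk.lt_or_eq with hk | rfl
    · exact Or.inl (by simpa using hk)
    · exact Or.inr rfl
  · rintro (hk | hk)
    · have : k < 0 := by simpa using hk
      exact this.le
    · rw [hk] at hv
      simp [bitsVal] at hv
      omega

theorem eq_bitsVal_of_eq_encodeInteger {l : List Bool} {k : ℤ}
    (h : false :: l = encodeInteger k) : k = bitsVal l := by
  rw [encodeInteger, List.cons.injEq] at h
  obtain ⟨hk, rfl⟩ := h
  rw [bitsVal_encodeNat]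
  have : 0 ≤ k := by simpa using hk.symm
  omega

end Integers

/-- A digit sequence in `x` from the position `s + 1` on, preceded by a sign, is the code of an
integer. -/
def IsIntegerAt (x : List Bool) (s : ℕ) : Prop :=
  (s + 1 = x.length ∧ x[s]? = some false) ∨
    ∃ p < x.length, p + 1 = x.length ∧ s + 1 ≤ p ∧ x[p]? = some true

theorem isIntegerAt_iff (x : List Bool) (s : ℕ) :
    IsIntegerAt x s ↔ ∃ k : ℤ, x.drop s = encodeInteger k := by
  rcases lt_or_ge s x.length with hs | hs
  · rw [List.drop_eq_getElem_cons hs, exists_encodeInteger_iff, IsIntegerAt]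
    refine or_congr ?_ ?_
    · rw [List.drop_eq_nil_iff, List.getElem?_eq_getElem hs, Option.some.injEq]
      exact and_congr (by omega) Iff.rfl
    · rw [List.getLast?_drop]
      constructor
      · rintro ⟨p, -, hp, hsp, h⟩
        rw [if_neg (by omega), List.getLast?_eq_getElem?, ← h, ← hp, Nat.add_sub_cancel]
      · intro h
        split_ifs at h with hle
        rw [List.getLast?_eq_getElem?] at h
        exact ⟨x.length - 1, by omega, by omega, by omega, h⟩
  · refine iff_of_false ?_ ?_
    · rintro (⟨h, -⟩ | ⟨p, hp, h, h', -⟩) <;> omega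
    · rintro ⟨k, hk⟩
      rw [List.drop_eq_nil_of_le hs] at hk
      simp [encodeInteger] at hk

/-- A table `T` of the values of the final segments of `x` shows that the number with the digits
from the position `s + 1` on is at most `m`. -/
def ShowsLe (x : List Bool) (s m : ℕ) (T : ℕ → ℕ → Prop) : Prop :=
  (∃ a < x.length, a ≤ m ∧ T (s + 1) a) ∧
    ∀ p < x.length, ∀ a < x.length, T p a →
      ∃ b < x.length, ((p + 1 = x.length ∧ b = 0) ∨ (p + 1 < x.length ∧ T (p + 1) b)) ∧
        ((x[p]? = some true ∧ a = b + b + 1) ∨ (x[p]? = some false ∧ a = b + b))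

/-- The local conditions on `T` are the Horner recursion for the digits, so they force each entry to
be the true value of its final segment. -/
theorem ShowsLe.bitsVal_le {x : List Bool} {s m : ℕ} {T : ℕ → ℕ → Prop} (h : ShowsLe x s m T)
    (hs : s + 1 < x.length) : bitsVal (x.drop (s + 1)) ≤ m := by
  obtain ⟨⟨a, ha, ham, hTa⟩, hT⟩ := h
  -- Here `d` is the distance from `p` to the last position of `x`.
  suffices key : ∀ d p a, p + d + 1 = x.length → a < x.length → T p a →
      a = bitsVal (x.drop p) by
    rw [← key (x.length - (s + 1) - 1) (s + 1) a (by omega) ha hTa]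
    exact ham
  intro d
  induction d with
  | zero =>
    intro p a hp ha hTa
    obtain ⟨b, -, hb, hab⟩ := hT p (by omega) a ha hTa
    obtain ⟨-, rfl⟩ : p + 1 = x.length ∧ b = 0 := by
      rcases hb with hb | hb
      · exact hb
      · omega
    have hp' : p < x.length := by omega
    rw [List.drop_eq_getElem_cons hp', List.drop_eq_nil_of_le (by omega)]
    rw [List.getElem?_eq_getElem hp'] at hab
    rcases hab with ⟨h, rfl⟩ | ⟨h, rfl⟩ <;> simp [Option.some.inj h, bitsVal]
  | succ d ih =>
    intro p a hp ha hTa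
    obtain ⟨b, hbx, hb, hab⟩ := hT p (by omega) a ha hTa
    obtain ⟨-, hTb⟩ : p + 1 < x.length ∧ T (p + 1) b := by
      rcases hb with hb | hb
      · omega
      · exact hb
    have hp' : p < x.length := by omega
    rw [List.drop_eq_getElem_cons hp', bitsVal, ← ih (p + 1) b (by omega) hbx hTb]
    rw [List.getElem?_eq_getElem hp'] at hab
    rcases hab with ⟨h, rfl⟩ | ⟨h, rfl⟩ <;> simp [Option.some.inj h, two_mul]

/-- The table of the true values qualifies: dropping the first digit roughly halves the value, so
whenever an entry is below `|x|`, so is the next one that it refers to. -/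
theorem showsLe {x : List Bool} {s m : ℕ} (hm : m < x.length)
    (h : bitsVal (x.drop (s + 1)) ≤ m) {T : ℕ → ℕ → Prop} (hs : s + 1 < x.length)
    (hT : ∀ p < x.length, ∀ a < x.length, T p a ↔ a = bitsVal (x.drop p)) : ShowsLe x s m T := by
  refine ⟨⟨_, h.trans_lt hm, h, (hT _ hs _ (h.trans_lt hm)).mpr rfl⟩, ?_⟩
  intro p hp a ha hTa
  have hab := (hT p hp a ha).mp hTa
  rw [List.drop_eq_getElem_cons hp, bitsVal] at hab
  have hb : bitsVal (x.drop (p + 1)) < x.length := by omega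
  refine ⟨_, hb, ?_, ?_⟩
  · rcases (show p + 1 ≤ x.length from hp).lt_or_eq with hlt | heq
    · exact Or.inr ⟨hlt, (hT _ hlt _ hb).mpr rfl⟩
    · exact Or.inl ⟨heq, by rw [List.drop_eq_nil_of_le heq.ge]; rfl⟩
  · rw [List.getElem?_eq_getElem hp]
    cases hx : x[p] <;> simp [hx] at hab ⊢ <;> omega

/-! ### Matrices and graphs -/

theorem length_encodeMatrix {n : ℕ} (r : Fin n → Fin n → Prop) :
    (encodeMatrix r).length = n * n := by
  simp [encodeMatrix, List.length_flatMap]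

theorem index_lt {n i j : ℕ} (hi : i < n) (hj : j < n) : i * n + j < n * n := by
  calc i * n + j < i * n + n := by omega
    _ = (i + 1) * n := by ring
    _ ≤ n * n := Nat.mul_le_mul_right n hi

theorem divNat_index {n : ℕ} (i j : Fin n) (h : i.1 * n + j.1 < n * n) :
    Fin.divNat ⟨i.1 * n + j.1, h⟩ = i := by
  ext
  simp only [Fin.coe_divNat]
  rw [Nat.add_comm, Nat.add_mul_div_right _ _ (by have := j.2; omega), Nat.div_eq_of_lt j.2,
    Nat.zero_add]

theorem modNat_index {n : ℕ} (i j : Fin n) (h : i.1 * n + j.1 < n * n) :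
    Fin.modNat ⟨i.1 * n + j.1, h⟩ = j := by
  ext
  simp only [Fin.coe_modNat]
  rw [Nat.add_comm, Nat.add_mul_mod_self_right, Nat.mod_eq_of_lt j.2]

open Classical in
theorem encodeMatrix_eq_ofFn {n : ℕ} (r : Fin n → Fin n → Prop) :
    encodeMatrix r = List.ofFn fun p : Fin (n * n) => decide (r p.divNat p.modNat) := by
  rw [List.ofFn_mul, encodeMatrix, List.flatMap_def, List.ofFn_eq_map]
  congr 1
  refine List.map_congr_left fun i _ => ?_
  rw [List.ofFn_eq_map]
  refine List.map_congr_left fun j _ => ?_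
  rw [divNat_index, modNat_index]

/-- The relation on `{0, …, n - 1}` given by the `n × n` matrix that starts at the position `o`
of `x`. -/
def BitAt (x : List Bool) (n o i j : ℕ) : Prop :=
  x[o + (i * n + j)]? = some true

theorem take_drop_eq_encodeMatrix_iff {x : List Bool} {n o : ℕ} (h : o + n * n ≤ x.length)
    (r : Fin n → Fin n → Prop) :
    (x.drop o).take (n * n) = encodeMatrix r ↔ ∀ i j, r i j ↔ BitAt x n o i j := by
  classical
  rw [encodeMatrix_eq_ofFn]
  constructor
  · intro he i j
    have hij := index_lt i.2 j.2
    have := congrArg (fun l => l[i.1 * n + j.1]?) he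
    simp only [List.getElem?_take_of_lt hij, List.getElem?_drop, List.getElem?_ofFn, hij,
      dif_pos] at this
    rw [BitAt, this, Option.some.injEq, decide_eq_true_iff]
    rw [divNat_index, modNat_index]
  · intro hr
    refine List.ext_getElem (by simp; omega) fun p hp hp' => ?_
    have hp'' : p < n * n := by simpa using hp'
    rw [List.getElem_take, List.getElem_drop, List.getElem_ofFn, Bool.eq_iff_iff,
      decide_eq_true_iff, hr, BitAt]
    simp only [Fin.coe_divNat, Fin.coe_modNat]
    rw [Nat.div_add_mod', List.getElem?_eq_getElem (by omega), Option.some.injEq]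

/-- The word `x` starts with the word `1ⁿ0` and the adjacency matrix of a graph. -/
structure IsGraphPrefix (x : List Bool) (n : ℕ) : Prop where
  unary : ∀ i < n, x[i]? = some true
  zero : x[n]? = some false
  symm : ∀ i < n, ∀ j < n, BitAt x n (n + 1) i j → BitAt x n (n + 1) j i
  irrefl : ∀ i < n, ¬ BitAt x n (n + 1) i i
  length : n + 1 + n * n ≤ x.length

/-- The order is the position of the first `false`. -/
theorem IsGraphPrefix.unique {x : List Bool} {n n' : ℕ} (h : IsGraphPrefix x n)
    (h' : IsGraphPrefix x n') : n = n' := by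
  rcases lt_trichotomy n n' with hlt | rfl | hlt
  · have := (h'.unary n hlt).symm.trans h.zero
    simp at this
  · rfl
  · have := (h.unary n' hlt).symm.trans h'.zero
    simp at this

theorem IsGraphPrefix.lt_length {x : List Bool} {n : ℕ} (h : IsGraphPrefix x n) : n < x.length := by
  have := h.length
  omega

theorem take_drop_append_drop (x : List Bool) (o k : ℕ) :
    (x.drop o).take k ++ x.drop (o + k) = x.drop o := by
  rw [← List.drop_drop, List.take_append_drop]

/-- The graph whose code is a prefix of a word. -/
def IsGraphPrefix.graph {x : List Bool} {n : ℕ} (h : IsGraphPrefix x n) :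
    SimpleGraph (Fin n) where
  Adj i j := BitAt x n (n + 1) i j
  symm := ⟨fun i j => h.symm i i.2 j j.2⟩
  loopless := ⟨fun i => h.irrefl i i.2⟩

theorem length_encodeGraph {n : ℕ} (G : SimpleGraph (Fin n)) :
    (encodeGraph G).length = n + 1 + n * n := by
  simp [encodeGraph, length_encodeMatrix]
  omega

theorem IsGraphPrefix.eq_append {x : List Bool} {n : ℕ} (h : IsGraphPrefix x n) :
    x = encodeGraph h.graph ++ x.drop (n + 1 + n * n) := by
  have hm := (take_drop_eq_encodeMatrix_iff h.length h.graph.Adj).mpr fun i j => Iff.rfl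
  have h₁ : x.take n = List.replicate n true := by
    refine List.ext_getElem? fun i => ?_
    rw [List.getElem?_take, List.getElem?_replicate]
    split_ifs with hi
    · exact h.unary i hi
    · rfl
  have h₂ : x.drop n = false :: x.drop (n + 1) := by
    obtain ⟨hn, hx⟩ := List.getElem?_eq_some_iff.mp h.zero
    rw [List.drop_eq_getElem_cons hn, hx]
  rw [encodeGraph, ← hm, ← h₁, List.append_assoc, List.cons_append, take_drop_append_drop, ← h₂,
    List.take_append_drop]

theorem getElem?_encodeGraph_append {n : ℕ} (G : SimpleGraph (Fin n)) (t : List Bool) :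
    IsGraphPrefix (encodeGraph G ++ t) n ∧
      ∀ i j, G.Adj i j ↔ BitAt (encodeGraph G ++ t) n (n + 1) i j := by
  have hlen : n + 1 + n * n ≤ (encodeGraph G ++ t).length := by
    rw [List.length_append, length_encodeGraph]
    omega
  have hadj := (take_drop_eq_encodeMatrix_iff hlen G.Adj).mp (by
    rw [encodeGraph, List.append_assoc, List.drop_append]
    simp [length_encodeMatrix])
  refine ⟨⟨fun i hi => ?_, ?_, fun i hi j hj h => ?_, fun i hi h => ?_, hlen⟩, hadj⟩
  · rw [encodeGraph, List.append_assoc, List.getElem?_append_left (by simpa using hi)]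
    simp [hi]
  · rw [encodeGraph, List.append_assoc, List.getElem?_append_right (by simp)]
    simp
  · exact (hadj ⟨j, hj⟩ ⟨i, hi⟩).mp ((hadj ⟨i, hi⟩ ⟨j, hj⟩).mpr h).symm
  · exact G.loopless.irrefl _ ((hadj ⟨i, hi⟩ ⟨i, hi⟩).mpr h)

/-- After a graph, the word `x` contains the matrix of the negative edges of a 2-edge-coloured
graph. -/
structure IsSignedPrefix (x : List Bool) (n : ℕ) : Prop extends IsGraphPrefix x n where
  neg_symm : ∀ i < n, ∀ j < n,
    BitAt x n (n + 1 + n * n) i j → BitAt x n (n + 1 + n * n) j i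
  neg_subset : ∀ i < n, ∀ j < n, BitAt x n (n + 1 + n * n) i j → BitAt x n (n + 1) i j
  neg_length : n + 1 + n * n + n * n ≤ x.length

/-- The 2-edge-coloured graph on a graph with a given symmetric relation of negative edges. -/
def TwoEdgeColoredGraph.ofRel {V : Type} (G : SimpleGraph V) (r : V → V → Prop) :
    TwoEdgeColoredGraph V where
  graph := G
  neg := {e | ∃ i j, G.Adj i j ∧ r i j ∧ e = s(i, j)}
  neg_subset := by
    rintro _ ⟨i, j, h, -, rfl⟩
    exact h

theorem TwoEdgeColoredGraph.mem_neg_ofRel {V : Type} {G : SimpleGraph V} {r : V → V → Prop}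
    (hr : ∀ i j, G.Adj i j → r i j → r j i) (i j : V) :
    s(i, j) ∈ (ofRel G r).neg ↔ G.Adj i j ∧ r i j := by
  constructor
  · rintro ⟨i', j', h, h', he⟩
    rcases Sym2.eq_iff.mp he with ⟨rfl, rfl⟩ | ⟨rfl, rfl⟩
    · exact ⟨h, h'⟩
    · exact ⟨h.symm, hr _ _ h h'⟩
  · rintro ⟨h, h'⟩
    exact ⟨i, j, h, h', rfl⟩

/-- The 2-edge-coloured graph whose code is a prefix of a word. -/
def IsSignedPrefix.graph {x : List Bool} {n : ℕ} (h : IsSignedPrefix x n) :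
    TwoEdgeColoredGraph (Fin n) :=
  .ofRel h.toIsGraphPrefix.graph fun i j => BitAt x n (n + 1 + n * n) i j

theorem IsSignedPrefix.mem_neg_graph {x : List Bool} {n : ℕ} (h : IsSignedPrefix x n)
    (i j : Fin n) : s(i, j) ∈ h.graph.neg ↔ BitAt x n (n + 1 + n * n) i j := by
  rw [graph, TwoEdgeColoredGraph.mem_neg_ofRel fun (i j : Fin n) _ => h.neg_symm i i.2 j j.2]
  exact and_iff_right_of_imp (h.neg_subset i i.2 j j.2)

theorem IsSignedPrefix.eq_append {x : List Bool} {n : ℕ} (h : IsSignedPrefix x n) :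
    x = encodeTwoEdgeColoredGraph h.graph ++ x.drop (n + 1 + n * n + n * n) := by
  have hm := (take_drop_eq_encodeMatrix_iff h.neg_length fun i j => s(i, j) ∈ h.graph.neg).mpr
    h.mem_neg_graph
  rw [encodeTwoEdgeColoredGraph, ← hm, List.append_assoc, take_drop_append_drop]
  exact h.toIsGraphPrefix.eq_append

theorem getElem?_encodeTwoEdgeColoredGraph_append {n : ℕ} (G : TwoEdgeColoredGraph (Fin n))
    (t : List Bool) : IsSignedPrefix (encodeTwoEdgeColoredGraph G ++ t) n ∧
      (∀ i j, G.graph.Adj i j ↔ BitAt (encodeTwoEdgeColoredGraph G ++ t) n (n + 1) i j) ∧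
      ∀ i j, s(i, j) ∈ G.neg ↔ BitAt (encodeTwoEdgeColoredGraph G ++ t) n (n + 1 + n * n) i j := by
  have hlen : n + 1 + n * n + n * n ≤ (encodeTwoEdgeColoredGraph G ++ t).length := by
    simp only [encodeTwoEdgeColoredGraph, List.length_append, length_encodeGraph,
      length_encodeMatrix]
    omega
  have hneg := (take_drop_eq_encodeMatrix_iff hlen fun i j => s(i, j) ∈ G.neg).mp (by
    rw [encodeTwoEdgeColoredGraph, List.append_assoc, ← length_encodeGraph G.graph,
      List.drop_left, List.take_left' (length_encodeMatrix _)])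
  obtain ⟨hp, hadj⟩ := getElem?_encodeGraph_append G.graph
    (encodeMatrix (fun i j => s(i, j) ∈ G.neg) ++ t)
  rw [← List.append_assoc, ← encodeTwoEdgeColoredGraph] at hp hadj
  refine ⟨⟨hp, fun i hi j hj h => ?_, fun i hi j hj h => ?_, hlen⟩, hadj, hneg⟩
  · refine (hneg ⟨j, hj⟩ ⟨i, hi⟩).mp ?_
    rw [Sym2.eq_swap]
    exact (hneg ⟨i, hi⟩ ⟨j, hj⟩).mpr h
  · exact (hadj ⟨i, hi⟩ ⟨j, hj⟩).mp
      (TwoEdgeColoredGraph.adj_of_mem_neg ((hneg ⟨i, hi⟩ ⟨j, hj⟩).mpr h))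

end

section

/-! ## Certificates for homomorphic images -/

/-- The relation in the block `c` of a list of bits that interleaves the `l × l` matrices of five
relations. -/
def Tab (v : List Bool) (l c p a : ℕ) : Prop :=
  v[5 * (p * l + a) + c]? = some true

/-- The bit `t` belongs to the table `t % 5`, row `t / 5 / l`, column `t / 5 % l`. With interleaved
tables, the table number enters the index as an added numeral. -/
theorem exists_tab (l : ℕ) (P : ℕ → ℕ → ℕ → Prop) : ∃ v : List Bool, v.length = 5 * (l * l) ∧
    ∀ c < 5, ∀ p < l, ∀ a < l, Tab v l c p a ↔ P c p a := by
  classical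
  refine ⟨(List.range (5 * (l * l))).map fun t => decide (P (t % 5) (t / 5 / l) (t / 5 % l)),
    by simp, fun c hc p hp a ha => ?_⟩
  have hlt := index_lt hp ha
  have h₁ : (5 * (p * l + a) + c) % 5 = c := by omega
  have h₂ : (5 * (p * l + a) + c) / 5 = p * l + a := by omega
  have h₃ : (p * l + a) / l = p := by
    rw [Nat.add_comm, Nat.add_mul_div_right _ _ (by omega), Nat.div_eq_of_lt ha, Nat.zero_add]
  have h₄ : (p * l + a) % l = a := by
    rw [Nat.add_comm, Nat.add_mul_mod_self_right, Nat.mod_eq_of_lt ha]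
  rw [Tab, List.getElem?_map, List.getElem?_range (by omega)]
  simp [h₁, h₂, h₃, h₄]

/-- The relations `F`, `KA` and `KN` are the graph of a map of `{0, …, n - 1}` onto
`{0, …, m - 1}`, and the adjacency and the negative edges of the image of a graph with adjacency
`A` and negative edges `N`. -/
structure ImageTable (n m : ℕ) (A N F KA KN : ℕ → ℕ → Prop) : Prop where
  total : ∀ i < n, ∃ a < m, F i a
  functional : ∀ i < n, ∀ a < m, ∀ b < m, F i a → F i b → a ≤ b
  surj : ∀ a < m, ∃ i < n, F i a
  adj : ∀ i < n, ∀ j < n, A i j → ∀ a < m, ∀ b < m, F i a → F j b → KA a b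
  neg : ∀ i < n, ∀ j < n, A i j ∧ N i j → ∀ a < m, ∀ b < m, F i a → F j b → KN a b
  pos : ∀ i < n, ∀ j < n, A i j ∧ ¬ N i j → ∀ a < m, ∀ b < m, F i a → F j b → ¬ KN a b
  edge : ∀ a < m, ∀ b < m, KA a b → ∃ i < n, ∃ j < n, A i j ∧ F i a ∧ F j b
  irrefl : ∀ a < m, ¬ KA a a

/-- Any two vertices are linked, in terms of the relations of adjacency and negative edges. -/
def LinkTable (m : ℕ) (KA KN : ℕ → ℕ → Prop) : Prop :=
  ∀ a < m, ∀ b < m, ¬ (a ≤ b ∧ b ≤ a) →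
    KA a b ∨ ∃ c < m, (KA a c ∧ KA b c) ∧ ¬ (KN a c ↔ KN b c)

/-- Any two vertices are linked in the signed graph, in terms of the relations of adjacency and
negative edges. -/
def SignLinkTable (m : ℕ) (KA KN : ℕ → ℕ → Prop) : Prop :=
  ∀ a < m, ∀ b < m, ¬ (a ≤ b ∧ b ≤ a) →
    KA a b ∨ ∃ c < m, ∃ d < m, (KA a c ∧ KA b c) ∧ (KA a d ∧ KA b d) ∧
      ¬ ((KN a c ↔ KN b c) ↔ (KN a d ↔ KN b d))

namespace TwoEdgeColoredGraph

/-- The relations `A` and `N` on the natural numbers describe the 2-edge-coloured graph `G`. -/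
structure IsTable {n : ℕ} (G : TwoEdgeColoredGraph (Fin n)) (A N : ℕ → ℕ → Prop) : Prop where
  adj : ∀ i j : Fin n, G.graph.Adj i j ↔ A i j
  neg : ∀ i j : Fin n, G.graph.Adj i j → (s(i, j) ∈ G.neg ↔ N i j)

/-- Symmetry of `KA` and `KN` on edges need not be demanded: every edge of the image comes from an
edge of `G`, which can be reversed. The condition `functional` asks only for `≤` and is used in both
orders. -/
theorem exists_of_imageTable {n m : ℕ} {G : TwoEdgeColoredGraph (Fin n)}
    {A N F KA KN : ℕ → ℕ → Prop} (hG : G.IsTable A N) (h : ImageTable n m A N F KA KN) :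
    ∃ K : TwoEdgeColoredGraph (Fin m), K.IsTable KA KN ∧ ∃ φ, IsSurjHom φ G K := by
  have hedge : ∀ a b : Fin m, KA a b → ∃ i j : Fin n, G.graph.Adj i j ∧ F i a ∧ F j b := by
    intro a b hab
    obtain ⟨i, hi, j, hj, hij, hia, hjb⟩ := h.edge a a.2 b b.2 hab
    exact ⟨⟨i, hi⟩, ⟨j, hj⟩, (hG.adj _ _).mpr hij, hia, hjb⟩
  have hsymm : ∀ a b : Fin m, KA a b → KA b a := by
    intro a b hab
    obtain ⟨i, j, hij, hia, hjb⟩ := hedge a b hab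
    exact h.adj j j.2 i i.2 ((hG.adj _ _).mp hij.symm) b b.2 a a.2 hjb hia
  let KG : SimpleGraph (Fin m) :=
    { Adj := fun a b => KA a b
      symm := ⟨hsymm⟩
      loopless := ⟨fun a => h.irrefl a a.2⟩ }
  have hneg : ∀ (i j : Fin n) (a b : Fin m), G.graph.Adj i j → F i a → F j b →
      (s(i, j) ∈ G.neg ↔ KN a b) := by
    intro i j a b hij hia hjb
    rw [hG.neg i j hij]
    constructor
    · exact fun hN => h.neg i i.2 j j.2 ⟨(hG.adj _ _).mp hij, hN⟩ a a.2 b b.2 hia hjb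
    · intro hK
      by_contra hN
      exact h.pos i i.2 j j.2 ⟨(hG.adj _ _).mp hij, hN⟩ a a.2 b b.2 hia hjb hK
  have hK : ∀ a b : Fin m, s(a, b) ∈ (ofRel KG fun a b => KN a b).neg ↔ KA a b ∧ KN a b := by
    refine mem_neg_ofRel fun (a b : Fin m) hab hN => ?_
    obtain ⟨i, j, hij, hia, hjb⟩ := hedge a b hab
    rw [← hneg j i b a hij.symm hjb hia, Sym2.eq_swap]
    exact (hneg i j a b hij hia hjb).mpr hN
  choose f hf hF using h.total
  refine ⟨ofRel KG fun a b => KN a b, ⟨fun a b => Iff.rfl, fun a b hab => ?_⟩,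
    fun i => ⟨f i i.2, hf i i.2⟩, fun i j hij => ⟨?_, ?_⟩, fun a => ?_, fun a b hab => ?_⟩
  · exact (hK a b).trans (and_iff_right hab)
  · exact h.adj i i.2 j j.2 ((hG.adj _ _).mp hij) _ (hf ..) _ (hf ..) (hF ..) (hF ..)
  · have hadj := h.adj i i.2 j j.2 ((hG.adj _ _).mp hij) _ (hf i i.2) _ (hf j j.2)
      (hF i i.2) (hF j j.2)
    rw [hK, hneg i j ⟨f i i.2, hf i i.2⟩ ⟨f j j.2, hf j j.2⟩ hij (hF ..) (hF ..)]
    exact (and_iff_right hadj).symm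
  · obtain ⟨i, hi, hia⟩ := h.surj a a.2
    refine ⟨⟨i, hi⟩, Fin.ext (le_antisymm ?_ ?_)⟩
    · exact h.functional i hi _ (hf ..) a a.2 (hF ..) hia
    · exact h.functional i hi a a.2 _ (hf ..) hia (hF ..)
  · obtain ⟨i, j, hij, hia, hjb⟩ := hedge a b hab
    refine ⟨i, j, hij, Fin.ext (le_antisymm ?_ ?_), Fin.ext (le_antisymm ?_ ?_)⟩
    · exact h.functional i i.2 _ (hf ..) a a.2 (hF ..) hia
    · exact h.functional i i.2 a a.2 _ (hf ..) hia (hF ..)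
    · exact h.functional j j.2 _ (hf ..) b b.2 (hF ..) hjb
    · exact h.functional j j.2 b b.2 _ (hf ..) hjb (hF ..)

theorem imageTable_of_isSurjHom {n m : ℕ} {G : TwoEdgeColoredGraph (Fin n)}
    {K : TwoEdgeColoredGraph (Fin m)} {φ : Fin n → Fin m} (hφ : IsSurjHom φ G K)
    {A N F KA KN : ℕ → ℕ → Prop} (hG : G.IsTable A N) (hK : K.IsTable KA KN)
    (hF : ∀ (i : Fin n) (a : Fin m), F i a ↔ φ i = a) : ImageTable n m A N F KA KN := by
  have hF' : ∀ (i : ℕ) (hi : i < n) (a : ℕ) (ha : a < m), F i a ↔ φ ⟨i, hi⟩ = ⟨a, ha⟩ :=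
    fun i hi a ha => hF ⟨i, hi⟩ ⟨a, ha⟩
  have hA : ∀ (i : ℕ) (hi : i < n) (j : ℕ) (hj : j < n), A i j ↔ G.graph.Adj ⟨i, hi⟩ ⟨j, hj⟩ :=
    fun i hi j hj => (hG.adj ⟨i, hi⟩ ⟨j, hj⟩).symm
  have hKA : ∀ (a : ℕ) (ha : a < m) (b : ℕ) (hb : b < m),
      KA a b ↔ K.graph.Adj ⟨a, ha⟩ ⟨b, hb⟩ := fun a ha b hb => (hK.adj ⟨a, ha⟩ ⟨b, hb⟩).symm
  refine ⟨fun i hi => ⟨φ ⟨i, hi⟩, (φ ⟨i, hi⟩).2, (hF ⟨i, hi⟩ _).mpr rfl⟩, ?_, ?_, ?_, ?_, ?_, ?_,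
    ?_⟩
  · intro i hi a ha b hb hia hib
    rw [hF' i hi a ha] at hia
    rw [hF' i hi b hb, hia, Fin.mk.injEq] at hib
    exact hib.le
  · intro a ha
    obtain ⟨i, hi⟩ := hφ.2.1 ⟨a, ha⟩
    exact ⟨i, i.2, (hF i ⟨a, ha⟩).mpr hi⟩
  · intro i hi j hj hij a ha b hb hia hjb
    rw [hF' i hi a ha] at hia
    rw [hF' j hj b hb] at hjb
    rw [hKA a ha b hb, ← hia, ← hjb]
    exact (hφ.1 _ _ ((hA i hi j hj).mp hij)).1
  · rintro i hi j hj ⟨hij, hN⟩ a ha b hb hia hjb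
    rw [hF' i hi a ha] at hia
    rw [hF' j hj b hb] at hjb
    have h := hφ.1 _ _ ((hA i hi j hj).mp hij)
    rw [hia, hjb] at h
    exact (hK.neg _ _ h.1).mp (h.2.mp ((hG.neg _ _ ((hA i hi j hj).mp hij)).mpr hN))
  · rintro i hi j hj ⟨hij, hN⟩ a ha b hb hia hjb hKN
    rw [hF' i hi a ha] at hia
    rw [hF' j hj b hb] at hjb
    have h := hφ.1 _ _ ((hA i hi j hj).mp hij)
    rw [hia, hjb] at h
    exact hN ((hG.neg _ _ ((hA i hi j hj).mp hij)).mp (h.2.mpr ((hK.neg _ _ h.1).mpr hKN)))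
  · intro a ha b hb hab
    obtain ⟨i, j, hij, hi, hj⟩ := hφ.2.2 _ _ ((hKA a ha b hb).mp hab)
    exact ⟨i, i.2, j, j.2, (hG.adj i j).mp hij, (hF i ⟨a, ha⟩).mpr hi, (hF j ⟨b, hb⟩).mpr hj⟩
  · intro a ha haa
    exact K.graph.loopless.irrefl _ ((hKA a ha a ha).mp haa)

/-- Distinctness is written with two inequalities, `≤` being the only comparison primitive to
formulas. -/
theorem linkTable_iff {m : ℕ} {K : TwoEdgeColoredGraph (Fin m)} {KA KN : ℕ → ℕ → Prop}
    (hK : K.IsTable KA KN) : LinkTable m KA KN ↔ ∀ a b, a ≠ b → K.Linked a b := by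
  have hne : ∀ a b : Fin m, a ≠ b ↔ ¬ (a.1 ≤ b.1 ∧ b.1 ≤ a.1) := by
    intro a b
    rw [ne_eq, Fin.ext_iff]
    omega
  have key : ∀ a b c : Fin m, ((KA a c ∧ KA b c) ∧ ¬ (KN a c ↔ KN b c)) ↔
      (K.graph.Adj a c ∧ K.graph.Adj b c ∧ ¬ (s(a, c) ∈ K.neg ↔ s(b, c) ∈ K.neg)) := by
    intro a b c
    rw [← hK.adj, ← hK.adj, and_assoc]
    refine and_congr_right fun hac => and_congr_right fun hbc => ?_
    rw [hK.neg a c hac, hK.neg b c hbc]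
  constructor
  · intro h a b hab
    rcases h a a.2 b b.2 ((hne a b).mp hab) with h | ⟨c, hc, h⟩
    · exact Or.inl ((hK.adj a b).mpr h)
    · exact Or.inr ⟨⟨c, hc⟩, (key a b ⟨c, hc⟩).mp h⟩
  · intro h a ha b hb hab
    rcases h ⟨a, ha⟩ ⟨b, hb⟩ ((hne _ _).mpr hab) with h | ⟨c, h⟩
    · exact Or.inl ((hK.adj ⟨a, ha⟩ ⟨b, hb⟩).mp h)
    · exact Or.inr ⟨c, c.2, (key ⟨a, ha⟩ ⟨b, hb⟩ c).mpr h⟩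

theorem signLinkTable_iff {m : ℕ} {K : TwoEdgeColoredGraph (Fin m)} {KA KN : ℕ → ℕ → Prop}
    (hK : K.IsTable KA KN) : SignLinkTable m KA KN ↔ ∀ a b, a ≠ b → K.SignLinked a b := by
  have hne : ∀ a b : Fin m, a ≠ b ↔ ¬ (a.1 ≤ b.1 ∧ b.1 ≤ a.1) := by
    intro a b
    rw [ne_eq, Fin.ext_iff]
    omega
  have key : ∀ a b c d : Fin m, ((KA a c ∧ KA b c) ∧ (KA a d ∧ KA b d) ∧
      ¬ ((KN a c ↔ KN b c) ↔ (KN a d ↔ KN b d))) ↔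
      ((K.graph.Adj a c ∧ K.graph.Adj b c) ∧ (K.graph.Adj a d ∧ K.graph.Adj b d) ∧
        ¬ ((s(a, c) ∈ K.neg ↔ s(b, c) ∈ K.neg) ↔ (s(a, d) ∈ K.neg ↔ s(b, d) ∈ K.neg))) := by
    intro a b c d
    rw [← hK.adj, ← hK.adj, ← hK.adj, ← hK.adj]
    refine and_congr_right fun hc => and_congr_right fun hd => ?_
    rw [hK.neg a c hc.1, hK.neg b c hc.2, hK.neg a d hd.1, hK.neg b d hd.2]
  constructor
  · intro h a b hab
    rcases h a a.2 b b.2 ((hne a b).mp hab) with h | ⟨c, hc, d, hd, h⟩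
    · exact Or.inl ((hK.adj a b).mpr h)
    · exact Or.inr ⟨⟨c, hc⟩, ⟨d, hd⟩, (key a b ⟨c, hc⟩ ⟨d, hd⟩).mp h⟩
  · intro h a ha b hb hab
    rcases h ⟨a, ha⟩ ⟨b, hb⟩ ((hne _ _).mpr hab) with h | ⟨c, d, h⟩
    · exact Or.inl ((hK.adj ⟨a, ha⟩ ⟨b, hb⟩).mp h)
    · exact Or.inr ⟨c, c.2, d, d.2, (key ⟨a, ha⟩ ⟨b, hb⟩ c d).mpr h⟩

end TwoEdgeColoredGraph

open TwoEdgeColoredGraph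

/-- The word `v` shows that the number encoded in `x` from the position `s` on is not positive, or
that the graph with adjacency `A` and negative edges `N` has an image of at least that order with
the property `L`. -/
def Certifies (L : ℕ → (ℕ → ℕ → Prop) → (ℕ → ℕ → Prop) → Prop) (x v : List Bool) (n s : ℕ)
    (A N : ℕ → ℕ → Prop) : Prop :=
  x[s]? = some true ∨ s + 1 = x.length ∨ ∃ m < x.length,
    ShowsLe x s m (Tab v x.length 3) ∧
    ImageTable n m A N (Tab v x.length 0) (Tab v x.length 1) (Tab v x.length 2) ∧
    L m (Tab v x.length 1) (Tab v x.length 2)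

/-- One statement for both kinds of cliques: `L` is the table form of the graph property `Q`. The
set `S` is a guess stored in `v`, so that the source graph itself may depend on the certificate. -/
theorem exists_certifies_iff {L : ℕ → (ℕ → ℕ → Prop) → (ℕ → ℕ → Prop) → Prop}
    {Q : ∀ {m : ℕ}, TwoEdgeColoredGraph (Fin m) → Prop}
    (hL : ∀ {m : ℕ} {K : TwoEdgeColoredGraph (Fin m)} {KA KN : ℕ → ℕ → Prop},
      K.IsTable KA KN → (L m KA KN ↔ Q K))
    {x : List Bool} {n s : ℕ} {k : ℤ} (hn : n < x.length) (hk : x.drop s = encodeInteger k)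
    (G : Set (Fin n) → TwoEdgeColoredGraph (Fin n)) (A : ℕ → ℕ → Prop)
    (N : List Bool → ℕ → ℕ → Prop)
    (hG : ∀ S v, (∀ i : Fin n, i ∈ S ↔ Tab v x.length 4 i 0) → (G S).IsTable A (N v)) :
    (∃ v : List Bool, v.length ≤ 5 * (x.length * x.length) ∧ Certifies L x v n s A (N v)) ↔
      k ≤ 0 ∨ ∃ m : ℕ, k ≤ m ∧ ∃ S, ∃ (K : TwoEdgeColoredGraph (Fin m)) (φ : Fin n → Fin m),
        IsSurjHom φ (G S) K ∧ Q K := by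
  have hs : s < x.length := by
    by_contra hs
    rw [List.drop_eq_nil_of_le (by omega)] at hk
    simp [encodeInteger] at hk
  rw [List.drop_eq_getElem_cons hs] at hk
  have hk₀ := nonpos_iff_of_eq_encodeInteger hk
  have hk₁ : ¬ k ≤ 0 → k = bitsVal (x.drop (s + 1)) ∧ s + 1 < x.length := by
    intro h
    rw [hk₀, not_or, Bool.not_eq_true, List.drop_eq_nil_iff] at h
    rw [h.1] at hk
    exact ⟨eq_bitsVal_of_eq_encodeInteger hk, by omega⟩
  constructor
  · rintro ⟨v, -, h⟩
    by_cases hk' : k ≤ 0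
    · exact Or.inl hk'
    · obtain ⟨hkv, hs'⟩ := hk₁ hk'
      rcases h with h | h | ⟨m, hm, hT, hI, hLm⟩
      · rw [List.getElem?_eq_getElem hs, Option.some.injEq] at h
        exact Or.inl (hk₀.mpr (Or.inl h))
      · omega
      · obtain ⟨K, hK, φ, hφ⟩ :=
          exists_of_imageTable (hG {i | Tab v x.length 4 i 0} v fun i => Iff.rfl) hI
        refine Or.inr ⟨m, ?_, _, K, φ, hφ, (hL hK).mp hLm⟩
        rw [hkv]
        exact_mod_cast hT.bitsVal_le hs'
  · intro h
    by_cases hk' : k ≤ 0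
    · refine ⟨[], by simp, ?_⟩
      rcases hk₀.mp hk' with h | h
      · exact Or.inl (by rw [List.getElem?_eq_getElem hs, h])
      · rw [List.drop_eq_nil_iff] at h
        exact Or.inr (Or.inl (by omega))
    · obtain ⟨hkv, hs'⟩ := hk₁ hk'
      obtain ⟨m, hkm, S, K, φ, hφ, hQ⟩ := h.resolve_left hk'
      have hmn : m ≤ n := le_of_surjective hφ.2.1
      -- The five tables are the map, the adjacency and the negative edges of the image, the values
      -- of the final segments of `x`, and the set `S`. They fit since `m ≤ n < |x|`.
      obtain ⟨v, hv, hT⟩ := exists_tab x.length fun c p a => match c with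
        | 0 => ∃ (hp : p < n) (ha : a < m), φ ⟨p, hp⟩ = ⟨a, ha⟩
        | 1 => ∃ (hp : p < m) (ha : a < m), K.graph.Adj ⟨p, hp⟩ ⟨a, ha⟩
        | 2 => ∃ (hp : p < m) (ha : a < m), s(⟨p, hp⟩, ⟨a, ha⟩) ∈ K.neg
        | 3 => a = bitsVal (x.drop p)
        | _ => ∃ hp : p < n, ⟨p, hp⟩ ∈ S
      have hK : K.IsTable (Tab v x.length 1) (Tab v x.length 2) := by
        refine ⟨fun a b => ?_, fun a b _ => ?_⟩
        · rw [hT 1 (by omega) a (by omega) b (by omega)]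
          simp
        · rw [hT 2 (by omega) a (by omega) b (by omega)]
          simp
      refine ⟨v, hv.le, Or.inr (Or.inr ⟨m, by omega, ?_, ?_, (hL hK).mpr hQ⟩)⟩
      · exact showsLe (by omega) (by rw [hkv] at hkm; exact_mod_cast hkm) hs'
          fun p hp a ha => hT 3 (by omega) p hp a ha
      · refine imageTable_of_isSurjHom hφ (hG S v fun i => ?_) hK fun i a => ?_
        · rw [hT 4 (by omega) i (by omega) 0 (by omega)]
          simp
        · rw [hT 0 (by omega) i (by omega) a (by omega)]
          simp

end

/-! ## Definability of the certificates -/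

namespace IdxTerm

variable {ι : Type}

/-- The sum of a term and a numeral. -/
def addNat (t : IdxTerm ι) : ℕ → IdxTerm ι
  | 0 => t
  | c + 1 => .add (t.addNat c) .one

@[simp] theorem val_one (e : ι → ℕ) : (one : IdxTerm ι).val e = 1 := rfl

@[simp] theorem val_var (e : ι → ℕ) (i : ι) : (var i).val e = e i := rfl

@[simp] theorem val_mul (e : ι → ℕ) (i j : ι) : (mul i j).val e = e i * e j := rfl

@[simp] theorem val_add (e : ι → ℕ) (s t : IdxTerm ι) : (add s t).val e = s.val e + t.val e := rfl

@[simp] theorem val_addNat (e : ι → ℕ) (t : IdxTerm ι) (c : ℕ) :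
    (t.addNat c).val e = t.val e + c := by
  induction c with
  | zero => rfl
  | succ c ih => simp [addNat, ih, Nat.add_assoc]

end IdxTerm

namespace WordFormula

open Function IdxTerm

section Connectives

variable {ι : Type} [DecidableEq ι]

/-- Disjunction. -/
def or (φ ψ : WordFormula ι) : WordFormula ι := .not (.and (.not φ) (.not ψ))

/-- Implication. -/
def imp (φ ψ : WordFormula ι) : WordFormula ι := .not (.and φ (.not ψ))

/-- Equivalence. -/
def iff (φ ψ : WordFormula ι) : WordFormula ι := .and (φ.imp ψ) (ψ.imp φ)

/-- Existential quantification. -/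
def ex (i : ι) (φ : WordFormula ι) : WordFormula ι := .not (.all i (.not φ))

/-- Strict comparison. -/
def lt (s t : IdxTerm ι) : WordFormula ι := .le (.add s .one) t

/-- Equality. -/
def eq (s t : IdxTerm ι) : WordFormula ι := .and (.le s t) (.le t s)

/-- Universal quantification over the numbers below a variable. -/
def allLt (i j : ι) (φ : WordFormula ι) : WordFormula ι := .all i ((lt (.var i) (.var j)).imp φ)

/-- Existential quantification over the numbers below a variable. -/
def exLt (i j : ι) (φ : WordFormula ι) : WordFormula ι := .ex i (.and (lt (.var i) (.var j)) φ)

variable (w : List TapeSym) (e : ι → ℕ) (φ ψ : WordFormula ι) (s t : IdxTerm ι)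

@[simp] theorem holds_sym (a : TapeSym) : (sym a t).Holds w e ↔ w[t.val e]? = some a := Iff.rfl

@[simp] theorem holds_le : (le s t).Holds w e ↔ s.val e ≤ t.val e := Iff.rfl

@[simp] theorem holds_not : (not φ).Holds w e ↔ ¬ φ.Holds w e := Iff.rfl

@[simp] theorem holds_and : (and φ ψ).Holds w e ↔ φ.Holds w e ∧ ψ.Holds w e := Iff.rfl

@[simp] theorem holds_or : (or φ ψ).Holds w e ↔ φ.Holds w e ∨ ψ.Holds w e := by
  simp only [or, holds_not, holds_and]
  tauto

@[simp] theorem holds_imp : (imp φ ψ).Holds w e ↔ (φ.Holds w e → ψ.Holds w e) := by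
  simp only [imp, holds_not, holds_and]
  tauto

@[simp] theorem holds_iff : (iff φ ψ).Holds w e ↔ (φ.Holds w e ↔ ψ.Holds w e) := by
  simp only [iff, holds_and, holds_imp]
  tauto

@[simp] theorem holds_ex (i : ι) :
    (ex i φ).Holds w e ↔ ∃ v < w.length, φ.Holds w (update e i v) := by
  simp [ex, Holds]

@[simp] theorem holds_lt : (lt s t).Holds w e ↔ s.val e < t.val e := Iff.rfl

@[simp] theorem holds_eq : (eq s t).Holds w e ↔ s.val e = t.val e := by
  simp only [eq, holds_and, holds_le]
  omega

variable {w e}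

/-- The primitive quantifier stops at the length of `w`, so a larger bound would be cut off; and `j
= i` would let the quantifier overwrite its own bound. -/
theorem holds_allLt {i j : ι} (hij : j ≠ i) (h : e j ≤ w.length) :
    (allLt i j φ).Holds w e ↔ ∀ v < e j, φ.Holds w (update e i v) := by
  simp only [allLt, Holds, holds_imp, holds_lt, val_var, update_self, update_of_ne hij]
  exact forall_congr' fun v => ⟨fun H hv => H (by omega) hv, fun H _ hv => H hv⟩

theorem holds_exLt {i j : ι} (hij : j ≠ i) (h : e j ≤ w.length) :
    (exLt i j φ).Holds w e ↔ ∃ v < e j, φ.Holds w (update e i v) := by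
  simp only [exLt, holds_ex, holds_and, holds_lt, val_var, update_self, update_of_ne hij]
  exact exists_congr fun v => ⟨fun H => H.2, fun H => ⟨by omega, H⟩⟩

end Connectives

/-! ### Positions of the three words in an encoded triple -/

theorem length_encodeTriple (x u v : List Bool) :
    (encodeTriple (x, u, v)).length = x.length + 1 + u.length + 1 + v.length := by
  simp [encodeTriple]
  omega

variable (x u v : List Bool)

theorem getElem?_encodeTriple_fst {t : ℕ} (h : t < x.length) :
    (encodeTriple (x, u, v))[t]? = x[t]?.map some := by
  rw [encodeTriple, List.getElem?_append_left (by simpa using h), List.getElem?_map]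

theorem getElem?_map_append_cons (r : List TapeSym) (t : ℕ) :
    (x.map some ++ none :: r)[x.length + 1 + t]? = r[t]? := by
  rw [List.getElem?_append_right (by simp; omega), List.length_map,
    show x.length + 1 + t - x.length = t + 1 by omega, List.getElem?_cons_succ]

theorem getElem?_encodeTriple_snd {t : ℕ} (h : t < u.length) :
    (encodeTriple (x, u, v))[x.length + 1 + t]? = u[t]?.map some := by
  rw [encodeTriple, getElem?_map_append_cons, List.getElem?_append_left (by simpa using h),
    List.getElem?_map]

theorem getElem?_encodeTriple_thd (t : ℕ) :
    (encodeTriple (x, u, v))[x.length + 1 + u.length + 1 + t]? = v[t]?.map some := by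
  rw [show x.length + 1 + u.length + 1 + t = x.length + 1 + (u.length + 1 + t) by omega,
    encodeTriple, getElem?_map_append_cons, getElem?_map_append_cons, List.getElem?_map]

/-- There are only two separators, so `frame` determines the lengths of `x` and `u`. -/
theorem getElem?_encodeTriple_eq_none {t : ℕ} : (encodeTriple (x, u, v))[t]? = some none ↔
    t = x.length ∨ t = x.length + 1 + u.length := by
  rcases lt_trichotomy t x.length with h | rfl | h
  · rw [getElem?_encodeTriple_fst x u v h]
    simp
    omega
  · simp [encodeTriple]
  obtain ⟨d, rfl⟩ := Nat.exists_eq_add_of_lt h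
  rw [Nat.add_right_comm]
  rcases lt_trichotomy d u.length with h | rfl | h
  · rw [getElem?_encodeTriple_snd x u v h]
    simp
    omega
  · simp [encodeTriple, getElem?_map_append_cons]
  obtain ⟨d, rfl⟩ := Nat.exists_eq_add_of_lt h
  rw [show x.length + 1 + (u.length + d + 1) = x.length + 1 + u.length + 1 + d by omega,
    getElem?_encodeTriple_thd]
  simp
  omega

/-- The variable `1` is the length of `x`, and the variable `2` is the position of the second
separator in the encoding of a triple. -/
def frame : WordFormula (Fin 12) :=
  .and (lt (.var 1) (.var 2)) (.and (sym none (.var 1)) (sym none (.var 2)))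

/-- The bit of `x` at `t` is `b`. -/
def fstBit (b : Bool) (t : IdxTerm (Fin 12)) : WordFormula (Fin 12) :=
  .and (lt t (.var 1)) (sym (some b) t)

/-- The bit of `u` at `t` is `b`. -/
def sndBit (b : Bool) (t : IdxTerm (Fin 12)) : WordFormula (Fin 12) :=
  .and (lt (.add (.add (.var 1) .one) t) (.var 2)) (sym (some b) (.add (.add (.var 1) .one) t))

/-- The bit of `v` at `t` is `b`. -/
def thdBit (b : Bool) (t : IdxTerm (Fin 12)) : WordFormula (Fin 12) :=
  sym (some b) (.add (.add (.var 2) .one) t)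

variable {x u v} {e : Fin 12 → ℕ}

theorem holds_frame : frame.Holds (encodeTriple (x, u, v)) e ↔
    e 1 = x.length ∧ e 2 = x.length + 1 + u.length := by
  simp only [frame, holds_and, holds_lt, holds_sym, val_var, getElem?_encodeTriple_eq_none]
  omega

/-- The guard in `fstBit` makes an index beyond the end of `x` fail instead of reading from `u`. The
last word `v` needs no guard. -/
theorem holds_fstBit (h₁ : e 1 = x.length) (b : Bool) (t : IdxTerm (Fin 12)) :
    (fstBit b t).Holds (encodeTriple (x, u, v)) e ↔ x[t.val e]? = some b := by
  simp only [fstBit, holds_and, holds_lt, holds_sym, val_var, h₁]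
  by_cases h : t.val e < x.length
  · simp [h, getElem?_encodeTriple_fst]
  · simp [h]

theorem holds_sndBit (h₁ : e 1 = x.length) (h₂ : e 2 = x.length + 1 + u.length) (b : Bool)
    (t : IdxTerm (Fin 12)) :
    (sndBit b t).Holds (encodeTriple (x, u, v)) e ↔ u[t.val e]? = some b := by
  simp only [sndBit, holds_and, holds_lt, holds_sym, val_var, val_add, val_one, h₁, h₂,
    Nat.add_lt_add_iff_left]
  by_cases h : t.val e < u.length
  · simp [h, getElem?_encodeTriple_snd]
  · simp [h]

theorem holds_thdBit (h₂ : e 2 = x.length + 1 + u.length) (b : Bool)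
    (t : IdxTerm (Fin 12)) :
    (thdBit b t).Holds (encodeTriple (x, u, v)) e ↔ v[t.val e]? = some b := by
  simp [thdBit, h₂, getElem?_encodeTriple_thd]

end WordFormula

namespace IdxTerm

/-- The quintuple of a term. -/
def five {ι : Type} (t : IdxTerm ι) : IdxTerm ι := .add (.add (.add (.add t t) t) t) t

@[simp] theorem val_five {ι : Type} (e : ι → ℕ) (t : IdxTerm ι) : t.five.val e = 5 * t.val e := by
  simp only [five, val_add]
  omega

end IdxTerm

/-! ### Formulas for tables, certificates and instances -/

namespace WordFormula

open Function IdxTerm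

section Tables

/-- `Tab v |x| c i a`. -/
def thdTab (c : ℕ) (i a : Fin 12) : WordFormula (Fin 12) :=
  thdBit true (.addNat (.five (.add (.mul i 1) (.var a))) c)

/-- `Tab v |x| c (i + 1) a`. -/
def thdTabSucc (c : ℕ) (i a : Fin 12) : WordFormula (Fin 12) :=
  thdBit true (.addNat (.five (.add (.add (.mul i 1) (.var 1)) (.var a))) c)

/-- `Tab u |x| 0 i j`. -/
def sndTab (i j : Fin 12) : WordFormula (Fin 12) :=
  sndBit true (.five (.add (.mul i 1) (.var j)))

/-- `Tab u |x| 0 i 0`. -/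
def sndSet (i : Fin 12) : WordFormula (Fin 12) := sndBit true (.five (.mul i 1))

/-- `Tab v |x| 4 i 0`. -/
def thdSet (i : Fin 12) : WordFormula (Fin 12) := thdBit true (.addNat (.five (.mul i 1)) 4)

/-- `BitAt x n (n + 1) i j`, where the variable `0` is `n`. -/
def adjBit (i j : Fin 12) : WordFormula (Fin 12) :=
  fstBit true (.add (.add (.var 0) .one) (.add (.mul i 0) (.var j)))

/-- `BitAt x n (n + 1 + n * n) i j`, where the variable `0` is `n`. -/
def negBit (i j : Fin 12) : WordFormula (Fin 12) :=
  fstBit true (.add (.add (.add (.var 0) .one) (.mul 0 0)) (.add (.mul i 0) (.var j)))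

variable {x u v : List Bool} {e : Fin 12 → ℕ}

theorem holds_thdTab (h₁ : e 1 = x.length) (h₂ : e 2 = x.length + 1 + u.length) (c : ℕ)
    (i a : Fin 12) :
    (thdTab c i a).Holds (encodeTriple (x, u, v)) e ↔ Tab v x.length c (e i) (e a) := by
  simp [thdTab, holds_thdBit h₂, h₁, Tab]

/-- Terms multiply variables only, so the row `i + 1` is reached by adding one row length. -/
theorem holds_thdTabSucc (h₁ : e 1 = x.length) (h₂ : e 2 = x.length + 1 + u.length) (c : ℕ)
    (i a : Fin 12) :
    (thdTabSucc c i a).Holds (encodeTriple (x, u, v)) e ↔ Tab v x.length c (e i + 1) (e a) := by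
  simp [thdTabSucc, holds_thdBit h₂, h₁, Tab, Nat.succ_mul]

theorem holds_sndTab (h₁ : e 1 = x.length) (h₂ : e 2 = x.length + 1 + u.length)
    (i a : Fin 12) :
    (sndTab i a).Holds (encodeTriple (x, u, v)) e ↔ Tab u x.length 0 (e i) (e a) := by
  simp [sndTab, holds_sndBit h₁ h₂, h₁, Tab]

theorem holds_sndSet (h₁ : e 1 = x.length) (h₂ : e 2 = x.length + 1 + u.length) (i : Fin 12) :
    (sndSet i).Holds (encodeTriple (x, u, v)) e ↔ Tab u x.length 0 (e i) 0 := by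
  simp [sndSet, holds_sndBit h₁ h₂, h₁, Tab]

theorem holds_thdSet (h₁ : e 1 = x.length) (h₂ : e 2 = x.length + 1 + u.length) (i : Fin 12) :
    (thdSet i).Holds (encodeTriple (x, u, v)) e ↔ Tab v x.length 4 (e i) 0 := by
  simp [thdSet, holds_thdBit h₂, h₁, Tab]

theorem holds_adjBit (h₁ : e 1 = x.length) (i j : Fin 12) :
    (adjBit i j).Holds (encodeTriple (x, u, v)) e ↔ BitAt x (e 0) (e 0 + 1) (e i) (e j) := by
  simp [adjBit, holds_fstBit h₁, BitAt]

theorem holds_negBit (h₁ : e 1 = x.length) (i j : Fin 12) :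
    (negBit i j).Holds (encodeTriple (x, u, v)) e ↔
      BitAt x (e 0) (e 0 + 1 + e 0 * e 0) (e i) (e j) := by
  simp [negBit, holds_fstBit h₁, BitAt]

end Tables

/-- The formula for `ImageTable`, where `N` with the variables `5` and `6` describes the negative
edges, and the variables `0` and `4` are the orders of the graph and of its image. -/
def imageTable (N : WordFormula (Fin 12)) : WordFormula (Fin 12) :=
  .and (allLt 5 0 (exLt 7 4 (thdTab 0 5 7))) <|
  .and (allLt 5 0 (allLt 7 4 (allLt 8 4
    ((thdTab 0 5 7).imp ((thdTab 0 5 8).imp (.le (.var 7) (.var 8))))))) <|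
  .and (allLt 7 4 (exLt 5 0 (thdTab 0 5 7))) <|
  .and (allLt 5 0 (allLt 6 0 ((adjBit 5 6).imp (allLt 7 4 (allLt 8 4
    ((thdTab 0 5 7).imp ((thdTab 0 6 8).imp (thdTab 1 7 8)))))))) <|
  .and (allLt 5 0 (allLt 6 0 ((WordFormula.and (adjBit 5 6) N).imp (allLt 7 4 (allLt 8 4
    ((thdTab 0 5 7).imp ((thdTab 0 6 8).imp (thdTab 2 7 8)))))))) <|
  .and (allLt 5 0 (allLt 6 0 ((WordFormula.and (adjBit 5 6) (.not N)).imp (allLt 7 4 (allLt 8 4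
    ((thdTab 0 5 7).imp ((thdTab 0 6 8).imp (.not (thdTab 2 7 8))))))))) <|
  .and (allLt 7 4 (allLt 8 4 ((thdTab 1 7 8).imp (exLt 5 0 (exLt 6 0
    (.and (adjBit 5 6) (.and (thdTab 0 5 7) (thdTab 0 6 8)))))))) <|
  allLt 7 4 (.not (thdTab 1 7 7))

/-- The formula for `LinkTable`, where the variable `4` is the order. -/
def linkTable : WordFormula (Fin 12) :=
  allLt 5 4 (allLt 6 4 ((WordFormula.not (.and (.le (.var 5) (.var 6)) (.le (.var 6) (.var 5)))).imp
    (.or (thdTab 1 5 6) (exLt 7 4 (.and (.and (thdTab 1 5 7) (thdTab 1 6 7))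
      (.not (.iff (thdTab 2 5 7) (thdTab 2 6 7))))))))

/-- The formula for `SignLinkTable`, where the variable `4` is the order. -/
def signLinkTable : WordFormula (Fin 12) :=
  allLt 5 4 (allLt 6 4 ((WordFormula.not (.and (.le (.var 5) (.var 6)) (.le (.var 6) (.var 5)))).imp
    (.or (thdTab 1 5 6) (exLt 7 4 (exLt 8 4
      (.and (.and (thdTab 1 5 7) (thdTab 1 6 7)) <|
      .and (.and (thdTab 1 5 8) (thdTab 1 6 8)) <|
      .not (.iff (.iff (thdTab 2 5 7) (thdTab 2 6 7)) (.iff (thdTab 2 5 8) (thdTab 2 6 8)))))))))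

/-- The formula for `ShowsLe`, where the variables `3` and `4` are the position and the bound. -/
def showsLe : WordFormula (Fin 12) :=
  .and (exLt 5 1 (.and (.le (.var 5) (.var 4)) (thdTabSucc 3 3 5))) <|
  allLt 5 1 (allLt 6 1 ((thdTab 3 5 6).imp (exLt 7 1 (.and
    (.or (.and (.eq (.add (.var 5) .one) (.var 1)) (.le (.add (.var 7) .one) .one))
      (.and (lt (.add (.var 5) .one) (.var 1)) (thdTabSucc 3 5 7)))
    (.or (.and (fstBit true (.var 5)) (.eq (.var 6) (.add (.add (.var 7) (.var 7)) .one)))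
      (.and (fstBit false (.var 5)) (.eq (.var 6) (.add (.var 7) (.var 7)))))))))

/-- The formula for `Certifies`, where the variables `0` and `3` are the order of the graph and the
position of the number. -/
def certifies (L N : WordFormula (Fin 12)) : WordFormula (Fin 12) :=
  .or (fstBit true (.var 3)) <| .or (.eq (.add (.var 3) .one) (.var 1)) <|
    exLt 4 1 (.and showsLe (.and (imageTable N) L))

/-- The formula for `IsIntegerAt`, where the variable `3` is the position. -/
def isIntegerAt : WordFormula (Fin 12) :=
  .or (.and (.eq (.add (.var 3) .one) (.var 1)) (fstBit false (.var 3))) <|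
    exLt 5 1 (.and (.eq (.add (.var 5) .one) (.var 1))
      (.and (.le (.add (.var 3) .one) (.var 5)) (fstBit true (.var 5))))

/-- The formula for `IsGraphPrefix`, where the variable `0` is the order. -/
def isGraphPrefix : WordFormula (Fin 12) :=
  .and (allLt 5 0 (fstBit true (.var 5))) <|
  .and (fstBit false (.var 0)) <|
  .and (allLt 5 0 (allLt 6 0 ((adjBit 5 6).imp (adjBit 6 5)))) <|
  .and (allLt 5 0 (.not (adjBit 5 5))) <|
  .le (.add (.add (.var 0) .one) (.mul 0 0)) (.var 1)

/-- The formula for `IsSignedPrefix`, where the variable `0` is the order. -/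
def isSignedPrefix : WordFormula (Fin 12) :=
  .and isGraphPrefix <|
  .and (allLt 5 0 (allLt 6 0 ((negBit 5 6).imp (negBit 6 5)))) <|
  .and (allLt 5 0 (allLt 6 0 ((negBit 5 6).imp (adjBit 5 6)))) <|
  .le (.add (.add (.add (.var 0) .one) (.mul 0 0)) (.mul 0 0)) (.var 1)

section Holds

variable {x u v : List Bool} {e : Fin 12 → ℕ}

/-- `N` stands outside the quantifiers over the variables `7` and `8`, so it is evaluated with only
`5` and `6` changed. -/
theorem holds_imageTable (h₁ : e 1 = x.length) (h₂ : e 2 = x.length + 1 + u.length)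
    (hn : e 0 ≤ (encodeTriple (x, u, v)).length) (hm : e 4 ≤ (encodeTriple (x, u, v)).length)
    (N : WordFormula (Fin 12)) : (imageTable N).Holds (encodeTriple (x, u, v)) e ↔
      ImageTable (e 0) (e 4) (BitAt x (e 0) (e 0 + 1))
        (fun i j => N.Holds (encodeTriple (x, u, v)) (update (update e 5 i) 6 j))
        (Tab v x.length 0) (Tab v x.length 1) (Tab v x.length 2) := by
  simp only [imageTable, holds_allLt, holds_exLt, holds_thdTab, holds_adjBit, holds_and, holds_imp,
    holds_not, holds_le, val_var, update_self, h₁, h₂, hn, hm, ne_eq, not_false_eq_true, update_of_ne,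
    Fin.reduceEq, Fin.isValue]
  exact ⟨fun ⟨h₁, h₂, h₃, h₄, h₅, h₆, h₇, h₈⟩ => ⟨h₁, h₂, h₃, h₄, h₅, h₆, h₇, h₈⟩,
    fun ⟨h₁, h₂, h₃, h₄, h₅, h₆, h₇, h₈⟩ => ⟨h₁, h₂, h₃, h₄, h₅, h₆, h₇, h₈⟩⟩

theorem holds_linkTable (h₁ : e 1 = x.length) (h₂ : e 2 = x.length + 1 + u.length)
    (hm : e 4 ≤ (encodeTriple (x, u, v)).length) :
    linkTable.Holds (encodeTriple (x, u, v)) e ↔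
      LinkTable (e 4) (Tab v x.length 1) (Tab v x.length 2) := by
  simp [linkTable, LinkTable, holds_allLt, holds_exLt, holds_thdTab, h₁, h₂, hm]

theorem holds_signLinkTable (h₁ : e 1 = x.length) (h₂ : e 2 = x.length + 1 + u.length)
    (hm : e 4 ≤ (encodeTriple (x, u, v)).length) :
    signLinkTable.Holds (encodeTriple (x, u, v)) e ↔
      SignLinkTable (e 4) (Tab v x.length 1) (Tab v x.length 2) := by
  simp [signLinkTable, SignLinkTable, holds_allLt, holds_exLt, holds_thdTab, h₁, h₂, hm]

theorem length_le_length_encodeTriple : x.length ≤ (encodeTriple (x, u, v)).length := by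
  rw [length_encodeTriple]
  omega

theorem holds_showsLe (h₁ : e 1 = x.length) (h₂ : e 2 = x.length + 1 + u.length) :
    showsLe.Holds (encodeTriple (x, u, v)) e ↔
      ShowsLe x (e 3) (e 4) (Tab v x.length 3) := by
  have h := length_le_length_encodeTriple (x := x) (u := u) (v := v)
  simp [showsLe, ShowsLe, holds_allLt, holds_exLt, holds_thdTab, holds_thdTabSucc, holds_fstBit, h₁,
    h₂, h]

theorem holds_certifies (h₁ : e 1 = x.length) (h₂ : e 2 = x.length + 1 + u.length)
    (hn : e 0 ≤ x.length) {φ N : WordFormula (Fin 12)}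
    {L : ℕ → (ℕ → ℕ → Prop) → (ℕ → ℕ → Prop) → Prop} {R : ℕ → ℕ → Prop}
    (hL : ∀ m ≤ (encodeTriple (x, u, v)).length,
      φ.Holds (encodeTriple (x, u, v)) (update e 4 m) ↔
        L m (Tab v x.length 1) (Tab v x.length 2))
    (hN : ∀ m i j, N.Holds (encodeTriple (x, u, v)) (update (update (update e 4 m) 5 i) 6 j) ↔
      R i j) :
    (certifies φ N).Holds (encodeTriple (x, u, v)) e ↔
      Certifies L x v (e 0) (e 3) (BitAt x (e 0) (e 0 + 1)) R := by
  have h := length_le_length_encodeTriple (x := x) (u := u) (v := v)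
  rw [certifies, Certifies, holds_or, holds_or, holds_exLt _ (by decide) (h₁.trans_le h),
    holds_fstBit h₁, holds_eq]
  simp only [val_add, val_var, val_one, h₁]
  refine or_congr Iff.rfl (or_congr Iff.rfl (exists_congr fun m => and_congr_right fun hm => ?_))
  have hm' := (hm.le.trans h)
  rw [holds_and, holds_and, hL m hm', holds_showsLe (by simpa using h₁) (by simpa using h₂),
    holds_imageTable (by simpa using h₁) (by simpa using h₂) (by simpa using hn.trans h)
      (by simpa using hm')]
  simp only [hN]
  simp

theorem holds_isIntegerAt (h₁ : e 1 = x.length) :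
    isIntegerAt.Holds (encodeTriple (x, u, v)) e ↔ IsIntegerAt x (e 3) := by
  have h := length_le_length_encodeTriple (x := x) (u := u) (v := v)
  simp [isIntegerAt, IsIntegerAt, holds_exLt, holds_fstBit, h₁, h]

theorem holds_isGraphPrefix (h₁ : e 1 = x.length) (hn : e 0 ≤ x.length) :
    isGraphPrefix.Holds (encodeTriple (x, u, v)) e ↔ IsGraphPrefix x (e 0) := by
  have h := hn.trans (length_le_length_encodeTriple (x := x) (u := u) (v := v))
  simp only [isGraphPrefix, holds_and, holds_allLt, holds_fstBit, holds_adjBit, holds_imp, holds_not,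
    holds_le, val_add, val_mul, val_var, val_one, update_self, h₁, h, ne_eq, not_false_eq_true,
    update_of_ne, Fin.reduceEq, Fin.isValue]
  exact ⟨fun ⟨h₁, h₂, h₃, h₄, h₅⟩ => ⟨h₁, h₂, h₃, h₄, h₅⟩,
    fun ⟨h₁, h₂, h₃, h₄, h₅⟩ => ⟨h₁, h₂, h₃, h₄, h₅⟩⟩

theorem holds_isSignedPrefix (h₁ : e 1 = x.length) (hn : e 0 ≤ x.length) :
    isSignedPrefix.Holds (encodeTriple (x, u, v)) e ↔ IsSignedPrefix x (e 0) := by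
  have h := hn.trans (length_le_length_encodeTriple (x := x) (u := u) (v := v))
  rw [isSignedPrefix, holds_and, holds_isGraphPrefix h₁ hn]
  simp only [holds_and, holds_allLt, holds_adjBit, holds_negBit, holds_imp,
    holds_le, val_add, val_mul, val_var, val_one, update_self, h₁, h, ne_eq, not_false_eq_true,
    update_of_ne, Fin.reduceEq, Fin.isValue]
  exact ⟨fun ⟨h₁, h₂, h₃, h₄⟩ => ⟨h₁, h₂, h₃, h₄⟩, fun ⟨h₁, h₂, h₃, h₄⟩ => ⟨h₁, h₂, h₃, h₄⟩⟩

end Holds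

end WordFormula

/-! ### From formulas to the class `Π₂` -/

namespace WordFormula

open Function IdxTerm

/-- The formula saying that `x` starts with the code of a graph with the property `pre`, followed
from the position `pos` on by the code of a number, and that `v` is a certificate for them. -/
def instanceFormula (pre : WordFormula (Fin 12)) (pos : IdxTerm (Fin 12))
    (φ N : WordFormula (Fin 12)) : WordFormula (Fin 12) :=
  .ex 1 (.ex 2 (.and frame (exLt 0 1 (exLt 3 1
    (.and (.eq (.var 3) pos) (.and isIntegerAt (.and pre (certifies φ N))))))))

theorem holds_instanceFormula {x u v : List Bool} {pre φ N : WordFormula (Fin 12)}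
    {t : IdxTerm (Fin 12)} {Pre : ℕ → Prop} {pos : ℕ → ℕ}
    {L : ℕ → (ℕ → ℕ → Prop) → (ℕ → ℕ → Prop) → Prop} {R : ℕ → ℕ → ℕ → Prop}
    (ht : ∀ e, t.val e = pos (e 0))
    (hpre : ∀ e : Fin 12 → ℕ, e 1 = x.length → e 0 ≤ x.length →
      (pre.Holds (encodeTriple (x, u, v)) e ↔ Pre (e 0)))
    (hφ : ∀ e : Fin 12 → ℕ, e 1 = x.length → e 2 = x.length + 1 + u.length →
      e 4 ≤ (encodeTriple (x, u, v)).length → (φ.Holds (encodeTriple (x, u, v)) e ↔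
        L (e 4) (Tab v x.length 1) (Tab v x.length 2)))
    (hN : ∀ e : Fin 12 → ℕ, e 1 = x.length → e 2 = x.length + 1 + u.length →
      (N.Holds (encodeTriple (x, u, v)) e ↔ R (e 0) (e 5) (e 6))) :
    (instanceFormula pre t φ N).Holds (encodeTriple (x, u, v)) (fun _ => 0) ↔
      ∃ n < x.length, ∃ s < x.length, s = pos n ∧ IsIntegerAt x s ∧ Pre n ∧
        Certifies L x v n s (BitAt x n (n + 1)) (R n) := by
  have hlen := length_encodeTriple x u v
  have key : ∀ e : Fin 12 → ℕ, e 1 = x.length → e 2 = x.length + 1 + u.length →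
      ((exLt 0 1 (exLt 3 1 (.and (.eq (.var 3) t) (.and isIntegerAt (.and pre
        (certifies φ N)))))).Holds (encodeTriple (x, u, v)) e ↔
      ∃ n < x.length, ∃ s < x.length, s = pos n ∧ IsIntegerAt x s ∧ Pre n ∧
        Certifies L x v n s (BitAt x n (n + 1)) (R n)) := by
    intro e h₁ h₂
    rw [holds_exLt _ (by decide) (by omega), h₁]
    refine exists_congr fun n => and_congr_right fun hn => ?_
    rw [holds_exLt _ (by decide) (by simp [h₁]; omega)]
    rw [update_of_ne (by decide), h₁]
    refine exists_congr fun s => and_congr_right fun hs => ?_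
    rw [holds_and, holds_and, holds_and, holds_eq, ht, holds_isIntegerAt (by simpa using h₁),
      hpre _ (by simpa using h₁) (by simpa using hn.le),
      holds_certifies (L := L) (R := R n) (by simpa using h₁) (by simpa using h₂)
        (by simpa using hn.le) (fun m hm => ?_) fun m i j => ?_]
    · simp
    · rw [hφ _ (by simpa using h₁) (by simpa using h₂) (by simpa using hm), update_self]
    · rw [hN _ (by simpa using h₁) (by simpa using h₂)]
      simp
  rw [instanceFormula, holds_ex]
  simp only [holds_ex, holds_and, holds_frame]
  constructor
  · rintro ⟨l, -, q, -, ⟨h₁, h₂⟩, h⟩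
    exact (key _ h₁ h₂).mp h
  · intro h
    have h₁ : update (update (fun _ => 0 : Fin 12 → ℕ) 1 x.length) 2 (x.length + 1 + u.length) 1 =
      x.length := by simp
    exact ⟨x.length, by omega, x.length + 1 + u.length, by omega, ⟨h₁, update_self ..⟩,
      (key _ h₁ (update_self ..)).mpr h⟩

end WordFormula

-- The relation finds the order and the position of the number only after `u` and `v` are given.
-- Both are determined by `x`, so they can be pulled in front of the quantifier over `u`.
open WordFormula in
theorem mem_PiTwoP_of_certifies {P : Language Bool} {pre φ N : WordFormula (Fin 12)}
    {t : IdxTerm (Fin 12)} {Pre : List Bool → ℕ → Prop} {pos : ℕ → ℕ}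
    {L : ℕ → (ℕ → ℕ → Prop) → (ℕ → ℕ → Prop) → Prop}
    {R : List Bool → List Bool → List Bool → ℕ → ℕ → ℕ → Prop}
    (hscope : (instanceFormula pre t φ N).WellScoped)
    (ht : ∀ e, t.val e = pos (e 0))
    (hpre : ∀ x u v (e : Fin 12 → ℕ), e 1 = x.length → e 0 ≤ x.length →
      (pre.Holds (encodeTriple (x, u, v)) e ↔ Pre x (e 0)))
    (hφ : ∀ x u v (e : Fin 12 → ℕ), e 1 = x.length → e 2 = x.length + 1 + u.length →
      e 4 ≤ (encodeTriple (x, u, v)).length → (φ.Holds (encodeTriple (x, u, v)) e ↔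
        L (e 4) (Tab v x.length 1) (Tab v x.length 2)))
    (hN : ∀ x u v (e : Fin 12 → ℕ), e 1 = x.length → e 2 = x.length + 1 + u.length →
      (N.Holds (encodeTriple (x, u, v)) e ↔ R x u v (e 0) (e 5) (e 6)))
    (hPre : ∀ x n, Pre x n → IsGraphPrefix x n)
    (hP : ∀ x, x ∈ P ↔ ∃ n, Pre x n ∧ ∃ k, x.drop (pos n) = encodeInteger k ∧
      ∀ u, u.length ≤ 5 * (x.length * x.length) → ∃ v, v.length ≤ 5 * (x.length * x.length) ∧
        Certifies L x v n (pos n) (BitAt x n (n + 1)) (R x u v n)) : P ∈ PiTwoP := by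
  refine ⟨5 * (.X * .X), _, polyTimeDecidable _ hscope, fun x => ?_⟩
  simp only [holds_instanceFormula ht (hpre x _ _) (hφ x _ _) (hN x _ _), Polynomial.eval_mul,
    Polynomial.eval_X, Polynomial.eval_ofNat, hP]
  constructor
  · rintro ⟨n, hn, k, hk, h⟩ u hu
    obtain ⟨v, hv, hc⟩ := h u hu
    refine ⟨v, hv, n, (hPre x n hn).lt_length, _, ?_, rfl, (isIntegerAt_iff _ _).mpr ⟨k, hk⟩, hn,
      hc⟩
    by_contra hs
    rw [List.drop_eq_nil_of_le (by omega)] at hk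
    simp [encodeInteger] at hk
  · intro h
    -- The empty `u` serves only to extract the order and the number; `IsGraphPrefix.unique` shows
    -- later that any other `u` yields the same order.
    obtain ⟨-, -, n, -, _, -, rfl, hk, hn, -⟩ := h [] (Nat.zero_le _)
    obtain ⟨k, hk⟩ := (isIntegerAt_iff _ _).mp hk
    refine ⟨n, hn, k, hk, fun u hu => ?_⟩
    obtain ⟨v, hv, n', -, _, -, rfl, -, hn', hc⟩ := h u hu
    rw [(hPre x n hn).unique (hPre x n' hn')]
    exact ⟨v, hv, hc⟩

/-! ### The three decision problems -/

section

open TwoEdgeColoredGraph WordFormula IdxTerm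

theorem exists_eq_encodeGraph_iff (x : List Bool) (Q : ∀ n, SimpleGraph (Fin n) → ℤ → Prop) :
    (∃ (n : ℕ) (G : SimpleGraph (Fin n)) (k : ℤ), x = encodeGraph G ++ encodeInteger k ∧ Q n G k) ↔
      ∃ (n : ℕ) (h : IsGraphPrefix x n) (k : ℤ), x.drop (n + 1 + n * n) = encodeInteger k ∧
        Q n h.graph k := by
  constructor
  · rintro ⟨n, G, k, rfl, hQ⟩
    obtain ⟨h, hadj⟩ := getElem?_encodeGraph_append G (encodeInteger k)
    have hG : h.graph = G := by
      ext i j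
      exact (hadj i j).symm
    exact ⟨n, h, k, List.drop_left' (length_encodeGraph G), by rwa [hG]⟩
  · rintro ⟨n, h, k, hk, hQ⟩
    exact ⟨n, h.graph, k, hk ▸ h.eq_append, hQ⟩

theorem exists_eq_encodeTwoEdgeColoredGraph_iff (x : List Bool)
    (Q : ∀ n, TwoEdgeColoredGraph (Fin n) → ℤ → Prop) :
    (∃ (n : ℕ) (G : TwoEdgeColoredGraph (Fin n)) (k : ℤ),
      x = encodeTwoEdgeColoredGraph G ++ encodeInteger k ∧ Q n G k) ↔
      ∃ (n : ℕ) (h : IsSignedPrefix x n) (k : ℤ),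
        x.drop (n + 1 + n * n + n * n) = encodeInteger k ∧ Q n h.graph k := by
  constructor
  · rintro ⟨n, G, k, rfl, hQ⟩
    obtain ⟨h, hadj, hneg⟩ := getElem?_encodeTwoEdgeColoredGraph_append G (encodeInteger k)
    have hG : h.graph = G := by
      refine ext_neg (SimpleGraph.ext ?_) fun i j => ?_
      · ext i j
        exact (hadj i j).symm
      · exact fun _ => by rw [h.mem_neg_graph, hneg]
    refine ⟨n, h, k, List.drop_left' ?_, by rwa [hG]⟩
    rw [encodeTwoEdgeColoredGraph, List.length_append, length_encodeGraph, length_encodeMatrix]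
  · rintro ⟨n, h, k, hk, hQ⟩
    exact ⟨n, h.graph, k, hk ▸ h.eq_append, hQ⟩

/-- The 2-edge-coloured graph on a graph, where `u` describes the negative edges. -/
def IsGraphPrefix.coloring {x : List Bool} {n : ℕ} (h : IsGraphPrefix x n) (u : List Bool) :
    TwoEdgeColoredGraph (Fin n) :=
  .ofRel h.graph fun i j => Tab u x.length 0 i j ∨ Tab u x.length 0 j i

theorem IsGraphPrefix.isTable_coloring {x : List Bool} {n : ℕ} (h : IsGraphPrefix x n)
    (u : List Bool) : (h.coloring u).IsTable (BitAt x n (n + 1)) fun i j =>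
      Tab u x.length 0 i j ∨ Tab u x.length 0 j i where
  adj _ _ := Iff.rfl
  neg i j hij :=
    (mem_neg_ofRel (fun (i j : Fin n) _ => (Or.symm : _ → Tab u x.length 0 j i ∨ _)) i j).trans
      (and_iff_right hij)

/-- Every word `u` is read as a signature, its table being symmetrised and restricted to edges, and
every signature arises in this way. Thus no validity check on `u` is needed. -/
theorem IsGraphPrefix.forall_coloring_iff {x : List Bool} {n : ℕ} (h : IsGraphPrefix x n)
    (p : TwoEdgeColoredGraph (Fin n) → Prop) : (∀ C, C.graph = h.graph → p C) ↔
      ∀ u : List Bool, u.length ≤ 5 * (x.length * x.length) → p (h.coloring u) := by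
  refine ⟨fun H u _ => H _ rfl, fun H C hC => ?_⟩
  obtain ⟨u, hu, hT⟩ := exists_tab x.length fun _ i j =>
    ∃ (hi : i < n) (hj : j < n), s(⟨i, hi⟩, ⟨j, hj⟩) ∈ C.neg
  have hn := h.lt_length
  have hT' : ∀ i j : Fin n, Tab u x.length 0 i j ↔ s(i, j) ∈ C.neg := by
    intro i j
    rw [hT 0 (by omega) i (by omega) j (by omega)]
    simp
  convert H u hu.le
  refine ext_neg hC fun i j hij => ?_
  rw [(h.isTable_coloring u).neg i j (by rwa [hC] at hij), hT', hT', Sym2.eq_swap (a := j), or_self]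

theorem TwoEdgeColoredGraph.IsTable.switch {n : ℕ} {G : TwoEdgeColoredGraph (Fin n)}
    {A N S : ℕ → ℕ → Prop} (hG : G.IsTable A N) {s : Set (Fin n)} (hs : ∀ i : Fin n, i ∈ s ↔ S i 0) :
    (G.switch s).IsTable A fun i j => N i j ↔ (S i 0 ↔ S j 0) where
  adj := hG.adj
  neg i j hij := by
    rw [mem_neg_switch, hs, hs, hG.neg i j hij]
    exact and_iff_right hij

theorem IsSignedPrefix.isTable {x : List Bool} {n : ℕ} (h : IsSignedPrefix x n) :
    h.graph.IsTable (BitAt x n (n + 1)) (BitAt x n (n + 1 + n * n)) where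
  adj _ _ := Iff.rfl
  neg i j _ := h.mem_neg_graph i j

theorem forall_set_iff {x : List Bool} {n : ℕ} (hn : n < x.length) (p : Set (Fin n) → Prop) :
    (∀ s, p s) ↔ ∀ u : List Bool, u.length ≤ 5 * (x.length * x.length) →
      p {i | Tab u x.length 0 i 0} := by
  refine ⟨fun H u _ => H _, fun H s => ?_⟩
  obtain ⟨u, hu, hT⟩ := exists_tab x.length fun _ i _ => ∃ hi : i < n, ⟨i, hi⟩ ∈ s
  convert H u hu.le
  ext i
  rw [Set.mem_ofPred_eq, hT 0 (by omega) i (by omega) 0 (by omega)]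
  simp

theorem exists_certifies_linkTable_iff {x : List Bool} {n s : ℕ} {k : ℤ} (hn : n < x.length)
    (hk : x.drop s = encodeInteger k) {G : TwoEdgeColoredGraph (Fin n)} {A N : ℕ → ℕ → Prop}
    (hG : G.IsTable A N) :
    (∃ v : List Bool, v.length ≤ 5 * (x.length * x.length) ∧ Certifies LinkTable x v n s A N) ↔
      k ≤ 0 ∨ ∃ m : ℕ, k ≤ m ∧ G.HasLinkedImage m := by
  rw [exists_certifies_iff linkTable_iff hn hk (fun _ => G) A (fun _ => N) fun _ _ _ => hG]
  simp only [exists_const, HasLinkedImage]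

/-- Here `u` is the set at which the given representative is switched, so that it ranges over the
whole class. -/
theorem signedMinAn_mem_piTwoP : SignedMinAn ∈ PiTwoP := by
  refine mem_PiTwoP_of_certifies (pre := isSignedPrefix) (φ := linkTable)
    (N := .iff (negBit 5 6) (.iff (sndSet 5) (sndSet 6)))
    (t := .add (.add (.add (.var 0) .one) (.mul 0 0)) (.mul 0 0))
    (Pre := IsSignedPrefix) (pos := fun n => n + 1 + n * n + n * n) (L := LinkTable)
    (R := fun x u _ n i j => BitAt x n (n + 1 + n * n) i j ↔
      (Tab u x.length 0 i 0 ↔ Tab u x.length 0 j 0))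
    ?_ (fun _ => rfl) (fun x u v e h₁ hn => holds_isSignedPrefix h₁ hn)
    (fun x u v e h₁ h₂ hm => holds_linkTable h₁ h₂ hm)
    (fun x u v e h₁ h₂ => by simp [holds_negBit h₁, holds_sndSet h₁ h₂])
    (fun x n h => h.toIsGraphPrefix) fun x => ?_
  · simp [WellScoped, bound, instanceFormula, frame, isIntegerAt, isGraphPrefix, isSignedPrefix,
      certifies, WordFormula.showsLe, imageTable, linkTable, allLt, exLt, WordFormula.ex,
      WordFormula.imp, WordFormula.iff, WordFormula.or, WordFormula.lt, WordFormula.eq, fstBit,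
      sndBit, thdBit, sndSet, thdTab, thdTabSucc, adjBit, negBit]
  have key : ∀ n (h : IsSignedPrefix x n) (k : ℤ),
      x.drop (n + 1 + n * n + n * n) = encodeInteger k →
      (k ≤ h.graph.toSigned.minAchromaticNumber ↔ _) := fun n h k hk =>
    (le_minAchromaticNumber_iff _ _).trans <| (forall_set_iff h.lt_length _).trans <|
      forall₂_congr fun u _ => (exists_certifies_linkTable_iff h.lt_length hk
        (h.isTable.switch (S := Tab u x.length 0) fun i => Iff.rfl)).symm
  refine (exists_eq_encodeTwoEdgeColoredGraph_iff x fun n G k =>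
    k ≤ G.toSigned.minAchromaticNumber).trans (exists_congr fun n => ?_)
  exact ⟨fun ⟨h, k, hk, hQ⟩ => ⟨h, k, hk, (key n h k hk).mp hQ⟩,
    fun ⟨h, k, hk, hc⟩ => ⟨h, k, hk, (key n h k hk).mpr hc⟩⟩

/-- Here `u` is the signature itself, and `v` makes no use of its table for a set. -/
theorem minTwoEcAn_mem_piTwoP : MinTwoEcAn ∈ PiTwoP := by
  refine mem_PiTwoP_of_certifies (pre := isGraphPrefix) (φ := linkTable)
    (N := .or (sndTab 5 6) (sndTab 6 5))
    (t := .add (.add (.var 0) .one) (.mul 0 0))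
    (Pre := IsGraphPrefix) (pos := fun n => n + 1 + n * n) (L := LinkTable)
    (R := fun x u _ n i j => Tab u x.length 0 i j ∨ Tab u x.length 0 j i)
    ?_ (fun _ => rfl) (fun x u v e h₁ hn => holds_isGraphPrefix h₁ hn)
    (fun x u v e h₁ h₂ hm => holds_linkTable h₁ h₂ hm)
    (fun x u v e h₁ h₂ => by simp [holds_sndTab h₁ h₂])
    (fun x n h => h) fun x => ?_
  · simp [WellScoped, bound, instanceFormula, frame, isIntegerAt, isGraphPrefix, certifies,
      WordFormula.showsLe, imageTable, linkTable, allLt, exLt, WordFormula.ex, WordFormula.imp,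
      WordFormula.iff, WordFormula.or, WordFormula.lt, WordFormula.eq, fstBit, sndBit, thdBit,
      sndTab, thdTab, thdTabSucc, adjBit]
  have key : ∀ n (h : IsGraphPrefix x n) (k : ℤ), x.drop (n + 1 + n * n) = encodeInteger k →
      (k ≤ min2ecAchromaticNumber h.graph ↔ _) := fun n h k hk =>
    (le_min2ecAchromaticNumber_iff _ _).trans <| (h.forall_coloring_iff _).trans <|
      forall₂_congr fun u _ =>
        (exists_certifies_linkTable_iff h.lt_length hk (h.isTable_coloring u)).symm
  refine (exists_eq_encodeGraph_iff x fun n G k => k ≤ min2ecAchromaticNumber G).trans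
    (exists_congr fun n => ?_)
  exact ⟨fun ⟨h, k, hk, hQ⟩ => ⟨h, k, hk, (key n h k hk).mp hQ⟩,
    fun ⟨h, k, hk, hc⟩ => ⟨h, k, hk, (key n h k hk).mpr hc⟩⟩

/-- The signature is universal, but `ψₛ` lets the representative that is mapped be chosen freely;
hence the switching set moves to the certificate `v`, in the table `4`. -/
theorem minSignedAn_mem_piTwoP : MinSignedAn ∈ PiTwoP := by
  refine mem_PiTwoP_of_certifies (pre := isGraphPrefix) (φ := signLinkTable)
    (N := .iff (.or (sndTab 5 6) (sndTab 6 5)) (.iff (thdSet 5) (thdSet 6)))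
    (t := .add (.add (.var 0) .one) (.mul 0 0))
    (Pre := IsGraphPrefix) (pos := fun n => n + 1 + n * n) (L := SignLinkTable)
    (R := fun x u v n i j => (Tab u x.length 0 i j ∨ Tab u x.length 0 j i) ↔
      (Tab v x.length 4 i 0 ↔ Tab v x.length 4 j 0))
    ?_ (fun _ => rfl) (fun x u v e h₁ hn => holds_isGraphPrefix h₁ hn)
    (fun x u v e h₁ h₂ hm => holds_signLinkTable h₁ h₂ hm)
    (fun x u v e h₁ h₂ => by simp [holds_sndTab h₁ h₂, holds_thdSet h₁ h₂])
    (fun x n h => h) fun x => ?_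
  · simp [WellScoped, bound, instanceFormula, frame, isIntegerAt, isGraphPrefix, certifies,
      WordFormula.showsLe, imageTable, signLinkTable, allLt, exLt, WordFormula.ex, WordFormula.imp,
      WordFormula.iff, WordFormula.or, WordFormula.lt, WordFormula.eq, fstBit, sndBit, thdBit,
      sndTab, thdSet, thdTab, thdTabSucc, adjBit]
  have key : ∀ n (h : IsGraphPrefix x n) (k : ℤ), x.drop (n + 1 + n * n) = encodeInteger k →
      (k ≤ minSignedAchromaticNumber h.graph ↔ _) := fun n h k hk =>
    (le_minSignedAchromaticNumber_iff _ _).trans <| (h.forall_coloring_iff _).trans <|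
      forall₂_congr fun u _ => (exists_certifies_iff signLinkTable_iff h.lt_length hk
        (fun s => (h.coloring u).switch s) _ _
        fun s v hs => (h.isTable_coloring u).switch (S := Tab v x.length 4) hs).symm
  refine (exists_eq_encodeGraph_iff x fun n G k => k ≤ minSignedAchromaticNumber G).trans
    (exists_congr fun n => ?_)
  exact ⟨fun ⟨h, k, hk, hQ⟩ => ⟨h, k, hk, (key n h k hk).mp hQ⟩,
    fun ⟨h, k, hk, hc⟩ => ⟨h, k, hk, (key n h k hk).mpr hc⟩⟩

end

theorem mainTheorem4 :
    SignedMinAn ∈ PiTwoP ∧ MinTwoEcAn ∈ PiTwoP ∧ MinSignedAn ∈ PiTwoP :=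
  ⟨signedMinAn_mem_piTwoP, minTwoEcAn_mem_piTwoP, minSignedAn_mem_piTwoP⟩
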